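/- **Setting.** A time grid is a set $\mathbb T=\{t_0,t_1,\dots\}$ with $0=t_0<t_1<\cdots$ and $t_n\to\infty$. Fix grids $\mathbb T_1\subset\mathbb T_2\subset\cdots$ with $\lim_N\sup_{t_i\in\mathbb T_N}|t_{i+1}-t_i|=0$. A path $X:[0,\infty)\to\mathbb R$ has continuous quadratic variation $[X]$ along $(\mathbb T_N)$ if for each $t>0$ the limit $$[X]_t=\lim_{N\to\infty}\sum_{t_i,t_{i+1}\in\mathbb T_N,\ t_{i+1}\le t}(X_{t_{i+1}}-X_{t_i})^2$$ exists and $t\mapsto[X]_t$, with $[X]_0=0$, is continuous on $[0,\infty)$. Let $S:[0,\infty)\to(0,\infty)$ be continuous with continuous quadratic variation along $(\mathbb T_N)$, let $r:[0,\infty)\to\mathbb R$ be measurable with $\int_0^t|r_s|\,ds<\infty$ for all $t>0$, and put $B_t=\exp\big(\int_0^tr_s\,ds\big)$. A function $\xi$ is an admissible integrand for $S$ if for each $T>0$ there are $n\in\mathbb N$, $g\in C^1(\mathbb R^{n+1})$ and a continuous $A:[0,\infty)\to\mathbb R^n$ with components of finite variation on $[0,T]$ such that $\xi_t=g(A_t,S_t)$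 for $0\le t\le T$. The pathwise Itô integral is $$\int_0^t\xi_s\,dS_s=\lim_{N\to\infty}\sum_{t_i,t_{i+1}\in\mathbb T_N,\ t_{i+1}\le t}\xi_{t_i}(S_{t_{i+1}}-S_{t_i}).$$ A pair $(\xi,\eta)$ of measurable functions on $[0,\infty)$ such that $\xi$ is an admissible integrand for $S$ and $\int_0^t|\eta_sr_s|\,ds<\infty$ for all $t\ge0$ is a self-financing strategy if its portfolio value $V_t=\xi_tS_t+\eta_tB_t$ satisfies $$V_t=V_0+\int_0^t\xi_s\,dS_s+\int_0^t\eta_s\,dB_s\qquad\text{for all }t\ge0,$$ where the last integral is a Lebesgue–Stieltjes integral. **Theorem.** Let $V_0\ge0$, $\alpha\in[0,1]$ and $m>0$. Then $\log S$ has continuous quadratic variation $[\log S]$ along $(\mathbb T_N)$. Define $$C_t=(1-\alpha)V_0\Big(\frac{S_t}{S_0}\Big)^mB_t^{1-m}e^{-\frac12m(m-1)[\log S]_t},\qquad V_t=C_t+\alpha V_0B_t,$$ $$\xi_t=\frac{mC_t}{S_t},\qquad \eta_t=\frac{V_t-\xi_tS_t}{B_t}=\frac{V_t-mC_t}{B_t}.$$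 Then $(\xi,\eta)$ is a self-financing strategy with portfolio value $V$, and $$V_t\ge\alpha V_0B_t\qquad\text{for all }t\ge0.$$ Moreover, $(\xi,\eta)$ is the unique self-financing strategy with initial value $V_0$ that follows the CPPI rules: if $(\tilde\xi,\tilde\eta)$ is a self-financing strategy whose portfolio value $\tilde V$ satisfies $\tilde V_0=V_0$, and if, with $\tilde C_t=\tilde V_t-\alpha V_0B_t$, one has $\tilde\xi_t=m\tilde C_t/S_t$ and $\tilde\eta_t=(\tilde V_t-\tilde\xi_tS_t)/B_t=(\tilde V_t-m\tilde C_t)/B_t$ for all $t\ge0$, then $\tilde\xi_t=\xi_t$ and $\tilde\eta_t=\eta_t$ for all $t\ge0$. -/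

import Mathlib

/-! Functions of time `t ∈ [0, ∞)` are modelled by functions `ℝ → ℝ` of which only the values on
`[0, ∞)` matter. -/

open Set Filter Topology MeasureTheory

noncomputable section

namespace PathwiseCPPI

/-- A time grid `𝕋 = {t₀, t₁, …}` with `0 = t₀ < t₁ < ⋯` and `tₙ → ∞`. -/
structure TimeGrid where
  pt : ℕ → ℝ
  pt_zero : pt 0 = 0
  strictMono : StrictMono pt
  tendsto_atTop : Tendsto pt atTop atTop

namespace TimeGrid

/-- The underlying set of time points of a grid. -/
def points (G : TimeGrid) : Set ℝ := range G.pt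

/-- The mesh `sup_i |t_{i+1} - t_i|`, possibly infinite. -/
def mesh (G : TimeGrid) : ENNReal := ⨆ i, ENNReal.ofReal |G.pt (i + 1) - G.pt i|

theorem finite_le (G : TimeGrid) (t : ℝ) : {i : ℕ | G.pt (i + 1) ≤ t}.Finite := by
  obtain ⟨n, hn⟩ := (G.tendsto_atTop.eventually_gt_atTop t).exists
  refine (finite_lt_nat n).subset fun i hi => ?_
  exact lt_of_lt_of_le (Nat.lt_succ_self i) (G.strictMono.lt_iff_lt.1 (lt_of_le_of_lt hi hn)).le

/-- The (finitely many) indices `i` with `t_{i+1} ≤ t`. -/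
def indices (G : TimeGrid) (t : ℝ) : Finset ℕ := (G.finite_le t).toFinset

theorem mem_indices {G : TimeGrid} {t : ℝ} {i : ℕ} : i ∈ G.indices t ↔ G.pt (i + 1) ≤ t := by
  simp [indices]

end TimeGrid

/-- A sequence of time grids `𝕋₀ ⊆ 𝕋₁ ⊆ ⋯` whose mesh tends to zero. -/
structure RefiningGrids where
  grid : ℕ → TimeGrid
  nested : ∀ N, (grid N).points ⊆ (grid (N + 1)).points
  mesh_tendsto : Tendsto (fun N => (grid N).mesh) atTop (𝓝 0)

/-- The sums `∑ (X_{t_{i+1}} - X_{t_i})²` over `t_i, t_{i+1} ∈ 𝕋_N` with `t_{i+1} ≤ t`. -/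
def quadVarSum (P : RefiningGrids) (X : ℝ → ℝ) (t : ℝ) (N : ℕ) : ℝ :=
  ∑ i ∈ (P.grid N).indices t, (X ((P.grid N).pt (i + 1)) - X ((P.grid N).pt i)) ^ 2

/-- The pathwise quadratic variation `[X]_t`, the limit of the sums of squared increments. It is
meaningful when the limit exists; for `t = 0` all sums are empty and `[X]_0 = 0`. -/
def quadVar (P : RefiningGrids) (X : ℝ → ℝ) (t : ℝ) : ℝ :=
  limUnder atTop (quadVarSum P X t)

/-- `X` has continuous quadratic variation along the grids: for each `t > 0` the limit defining
`[X]_t` exists, and `t ↦ [X]_t` is continuous on `[0, ∞)`. -/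
def HasContinuousQuadVar (P : RefiningGrids) (X : ℝ → ℝ) : Prop :=
  (∀ t, 0 < t → ∃ q, Tendsto (quadVarSum P X t) atTop (𝓝 q)) ∧
    ContinuousOn (quadVar P X) (Ici 0)

/-- `ξ` is an admissible integrand for `X`: for each `T > 0` it is of the form
`ξ_t = g(A_t, X_t)` on `[0, T]`, with `g` a `C¹` function on `ℝⁿ × ℝ` and `A` a continuous `ℝⁿ`-valued
function with components of finite variation on `[0, T]`. -/
def IsAdmissibleIntegrand (X ξ : ℝ → ℝ) : Prop :=
  ∀ T : ℝ, 0 < T → ∃ (n : ℕ) (g : (Fin n → ℝ) × ℝ → ℝ) (A : ℝ → Fin n → ℝ),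
    ContDiff ℝ 1 g ∧ ContinuousOn A (Ici 0) ∧
    (∀ k, BoundedVariationOn (fun t => A t k) (Icc 0 T)) ∧
    ∀ t ∈ Icc 0 T, ξ t = g (A t, X t)

/-- The pathwise Itô integral `∫₀ᵗ ξ dX` exists, as the limit of the nonanticipative Riemann sums
`∑ ξ_{t_i} (X_{t_{i+1}} - X_{t_i})` over `t_i, t_{i+1} ∈ 𝕋_N` with `t_{i+1} ≤ t`, and equals `I`. -/
def HasItoIntegral (P : RefiningGrids) (ξ X : ℝ → ℝ) (t I : ℝ) : Prop :=
  Tendsto (fun N => ∑ i ∈ (P.grid N).indices t,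
    ξ ((P.grid N).pt i) * (X ((P.grid N).pt (i + 1)) - X ((P.grid N).pt i))) atTop (𝓝 I)

/-- The path `F` on `[0, t]`, extended to `ℝ` by its values at the two endpoints. -/
def stopped (F : ℝ → ℝ) (t : ℝ) : ℝ → ℝ := fun s => F (max 0 (min s t))

/-- The Lebesgue–Stieltjes integral `∫₀ᵗ η dF` exists (`F` has finite variation on `[0, t]`, and
`η` is integrable for the associated signed Stieltjes measure) and equals `J`. -/
def HasStieltjesIntegral (η F : ℝ → ℝ) (t J : ℝ) : Prop :=
  ∃ hF : BoundedVariationOn (stopped F t) univ,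
    hF.vectorMeasure.IntegrableOn η (Ioc 0 t) ∧
    ∫ᵛ s in Ioc 0 t, η s ∂•hF.vectorMeasure = J

/-- The bond price `B_t = exp(∫₀ᵗ r_s ds)`. -/
def bond (r : ℝ → ℝ) (t : ℝ) : ℝ := Real.exp (∫ s in (0 : ℝ)..t, r s)

/-- The portfolio value `V_t = ξ_t S_t + η_t B_t`. -/
def portfolioValue (r S ξ η : ℝ → ℝ) (t : ℝ) : ℝ := ξ t * S t + η t * bond r t

/-- `(ξ, η)` is a self-financing strategy for the stock `S` and the bond with short rate `r`. -/
structure IsSelfFinancing (P : RefiningGrids) (r S ξ η : ℝ → ℝ) : Prop where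
  measurable_stock : Measurable fun t : Ici (0 : ℝ) => ξ t
  measurable_bond : Measurable fun t : Ici (0 : ℝ) => η t
  admissible : IsAdmissibleIntegrand S ξ
  integrable : ∀ t, 0 ≤ t → IntegrableOn (fun s => η s * r s) (Icc 0 t)
  value_eq : ∀ t, 0 ≤ t → ∃ I J,
    HasItoIntegral P ξ S t I ∧ HasStieltjesIntegral η (bond r) t J ∧
    portfolioValue r S ξ η t = portfolioValue r S ξ η 0 + I + J

/-- The strategy `(ξ, η)` has initial value `V₀` and obeys the CPPI rules: with
`V_t = ξ_t S_t + η_t B_t` its portfolio value and `C_t = V_t - α V₀ B_t` its cushion, one has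
`ξ_t = m C_t / S_t` and `η_t = (V_t - ξ_t S_t) / B_t = (V_t - m C_t) / B_t` for all `t ≥ 0`. -/
structure FollowsCPPI (r S : ℝ → ℝ) (V₀ α m : ℝ) (ξ η : ℝ → ℝ) : Prop where
  initial : portfolioValue r S ξ η 0 = V₀
  stock_eq : ∀ t, 0 ≤ t →
    ξ t = m * (portfolioValue r S ξ η t - α * V₀ * bond r t) / S t
  bond_eq : ∀ t, 0 ≤ t →
    η t = (portfolioValue r S ξ η t - ξ t * S t) / bond r t
  bond_eq' : ∀ t, 0 ≤ t →
    η t = (portfolioValue r S ξ η t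
      - m * (portfolioValue r S ξ η t - α * V₀ * bond r t)) / bond r t

/-- The cushion
`C_t = (1 - α) V₀ (S_t / S_0)^m B_t^(1 - m) exp(-½ m (m - 1) [log S]_t)`. -/
def cppiCushion (P : RefiningGrids) (r S : ℝ → ℝ) (V₀ α m : ℝ) (t : ℝ) : ℝ :=
  (1 - α) * V₀ * (S t / S 0) ^ m * bond r t ^ (1 - m) *
    Real.exp (-(1 / 2) * m * (m - 1) * quadVar P (fun s => Real.log (S s)) t)

/-- The value `V_t = C_t + α V₀ B_t`. -/
def cppiValue (P : RefiningGrids) (r S : ℝ → ℝ) (V₀ α m : ℝ) (t : ℝ) : ℝ :=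
  cppiCushion P r S V₀ α m t + α * V₀ * bond r t

/-- The number of shares `ξ_t = m C_t / S_t`. -/
def cppiStock (P : RefiningGrids) (r S : ℝ → ℝ) (V₀ α m : ℝ) (t : ℝ) : ℝ :=
  m * cppiCushion P r S V₀ α m t / S t

/-- The number of bonds `η_t = (V_t - m C_t) / B_t`. -/
def cppiBond (P : RefiningGrids) (r S : ℝ → ℝ) (V₀ α m : ℝ) (t : ℝ) : ℝ :=
  (cppiValue P r S V₀ α m t - m * cppiCushion P r S V₀ α m t) / bond r t

end PathwiseCPPI

end

/-! Every assertion is reduced to sums of one-step increments along the grids, with errors whose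
absolute values sum to `o(1)` (`Negligible`). Write `l`, `b`, `q`, `y` for the increments of `log
S`, `log B`, `[log S]` and of the log-cushion `Y`, so that `y = m l + (1 - m) b - ½ m (m - 1) q`.

Existence. Expanding `exp` to second order, `ξ ΔS + η ΔB - ΔV` equals `-½ m (m - 1) C (l² - q)` plus
a negligible array (`inc_cppi_eq`); the exponent of `C` is chosen to produce exactly this
compensated square. The sums of `l²` converge to `[log S]` at every time, hence also when weighted
by a continuous function (`tendsto_sum_val_mul_zero`), so the compensated squares vanish in the
limit. Thus the Itô sums converge, and to the value that self-financing requires; no general Itô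
formula is needed. The same weighted convergence yields `[log S]` as the limit of the sums of `S⁻²
(ΔS)²`.

Uniqueness. Let `K` be the cushion of a CPPI strategy. It suffices that `K exp(-Y)` is constant,
which needs a product rule and hence control of `ΔK` on each grid interval. For an admissible
integrand the integral has increments `ξ ΔS + p ((ΔS)² - Δ[S])` up to a negligible array, with `p`
continuous (`exists_negligible_ito_increment`). This is a Taylor estimate on the points of finer
grids inside one interval, where nestedness of the grids enters. In the product rule the terms of
order `l²` again combine to `-½ m (m - 1) (l² - q)` (`inc_discounted_cushion_eq`), so the increments
of `K exp(-Y)` sum to zero in the limit. -/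

noncomputable section

namespace PathwiseCPPI

/-! ### Index sets and telescoping on a single grid. -/

namespace TimeGrid

theorem pt_mono (G : TimeGrid) {i j : ℕ} (h : i ≤ j) : G.pt i ≤ G.pt j := G.strictMono.monotone h

theorem pt_nonneg (G : TimeGrid) (i : ℕ) : 0 ≤ G.pt i := G.pt_zero ▸ G.pt_mono (Nat.zero_le i)

theorem pt_le_pt_succ (G : TimeGrid) (i : ℕ) : G.pt i ≤ G.pt (i + 1) := G.pt_mono i.le_succ

theorem pt_mem_Icc {G : TimeGrid} {t : ℝ} {i : ℕ} (hi : i ∈ G.indices t) : G.pt i ∈ Icc 0 t :=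
  ⟨G.pt_nonneg i, (G.pt_le_pt_succ i).trans (mem_indices.1 hi)⟩

theorem pt_succ_mem_Icc {G : TimeGrid} {t : ℝ} {i : ℕ} (hi : i ∈ G.indices t) :
    G.pt (i + 1) ∈ Icc 0 t :=
  ⟨G.pt_nonneg _, mem_indices.1 hi⟩

theorem indices_mono (G : TimeGrid) {s t : ℝ} (h : s ≤ t) : G.indices s ⊆ G.indices t :=
  fun _ hi => mem_indices.2 ((mem_indices.1 hi).trans h)

theorem indices_pt (G : TimeGrid) (k : ℕ) : G.indices (G.pt k) = Finset.range k := by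
  ext i
  rw [mem_indices, G.strictMono.le_iff_le, Finset.mem_range]
  exact Nat.succ_le_iff

/-- The index of the last grid point not exceeding `t`. -/
def lastIndex (G : TimeGrid) (t : ℝ) : ℕ := (G.indices t).card

/-- The index set is downward closed, so its cardinality determines it. -/
theorem indices_eq_range (G : TimeGrid) (t : ℝ) : G.indices t = Finset.range (G.lastIndex t) := by
  apply (Finset.eq_of_subset_of_card_le _ (by simp [lastIndex])).symm
  intro i hi
  by_contra h
  have hsub : G.indices t ⊆ Finset.range i := fun j hj => by
    rw [Finset.mem_range]
    by_contra hij
    exact h (mem_indices.2 ((G.pt_mono (by omega)).trans (mem_indices.1 hj)))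
  have := Finset.card_le_card hsub
  rw [Finset.card_range] at this
  rw [Finset.mem_range, lastIndex] at hi
  omega

theorem lt_pt_lastIndex_succ (G : TimeGrid) (t : ℝ) : t < G.pt (G.lastIndex t + 1) := by
  by_contra h
  have := mem_indices.2 (not_lt.1 h)
  rw [indices_eq_range] at this
  simp at this

theorem pt_lastIndex_le (G : TimeGrid) {t : ℝ} (ht : 0 ≤ t) : G.pt (G.lastIndex t) ≤ t := by
  rcases Nat.eq_zero_or_pos (G.lastIndex t) with h | h
  · rw [h, G.pt_zero]; exact ht
  · obtain ⟨k, hk⟩ := Nat.exists_eq_succ_of_ne_zero h.ne'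
    have : k ∈ G.indices t := by rw [indices_eq_range]; simp [hk]
    rw [hk]
    exact mem_indices.1 this

theorem sum_indices_sub (G : TimeGrid) (X : ℝ → ℝ) (t : ℝ) :
    ∑ i ∈ G.indices t, (X (G.pt (i + 1)) - X (G.pt i)) = X (G.pt (G.lastIndex t)) - X 0 := by
  rw [indices_eq_range, Finset.sum_range_sub (fun i => X (G.pt i)), G.pt_zero]

theorem sum_indices_pt_sub (G : TimeGrid) (f : ℕ → ℝ) {a b : ℕ} (h : a ≤ b) :
    ∑ i ∈ G.indices (G.pt b), f i - ∑ i ∈ G.indices (G.pt a), f i = ∑ i ∈ Finset.Ico a b, f i := by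
  rw [indices_pt, indices_pt, Finset.sum_Ico_eq_sub _ h]

end TimeGrid

/-! ### Nestedness and vanishing mesh. -/

namespace RefiningGrids

theorem points_mono (P : RefiningGrids) {M N : ℕ} (h : M ≤ N) :
    (P.grid M).points ⊆ (P.grid N).points :=
  monotone_nat_of_le_succ (f := fun N => (P.grid N).points) P.nested h

theorem exists_pt_eq (P : RefiningGrids) {M N : ℕ} (h : M ≤ N) (i : ℕ) :
    ∃ k, (P.grid N).pt k = (P.grid M).pt i :=
  P.points_mono h ⟨i, rfl⟩

theorem eventually_step_lt (P : RefiningGrids) {δ : ℝ} (hδ : 0 < δ) :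
    ∀ᶠ N in atTop, ∀ i, (P.grid N).pt (i + 1) - (P.grid N).pt i < δ := by
  have h := P.mesh_tendsto.eventually (gt_mem_nhds (ENNReal.ofReal_pos.2 hδ))
  filter_upwards [h] with N hN i
  have h1 : ENNReal.ofReal |(P.grid N).pt (i + 1) - (P.grid N).pt i| < ENNReal.ofReal δ :=
    (le_iSup (fun i => ENNReal.ofReal |(P.grid N).pt (i + 1) - (P.grid N).pt i|) i).trans_lt hN
  exact (le_abs_self _).trans_lt ((ENNReal.ofReal_lt_ofReal_iff hδ).1 h1)

theorem tendsto_lastPt (P : RefiningGrids) {t : ℝ} (ht : 0 ≤ t) :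
    Tendsto (fun N => (P.grid N).pt ((P.grid N).lastIndex t)) atTop (𝓝 t) := by
  rw [Metric.tendsto_atTop']
  intro ε hε
  obtain ⟨n, hn⟩ := eventually_atTop.1 (P.eventually_step_lt hε)
  refine ⟨n, fun N hN => ?_⟩
  have h1 := hn N hN.le ((P.grid N).lastIndex t)
  have h2 := (P.grid N).pt_lastIndex_le ht
  have h3 := (P.grid N).lt_pt_lastIndex_succ t
  rw [Real.dist_eq, abs_lt]
  constructor <;> linarith

theorem tendsto_apply_lastPt (P : RefiningGrids) {t : ℝ} (ht : 0 ≤ t) {X : ℝ → ℝ}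
    (hX : ContinuousOn X (Icc 0 t)) :
    Tendsto (fun N => X ((P.grid N).pt ((P.grid N).lastIndex t))) atTop (𝓝 (X t)) := by
  refine (hX t ⟨ht, le_rfl⟩).tendsto.comp (tendsto_nhdsWithin_iff.2 ⟨P.tendsto_lastPt ht, ?_⟩)
  exact Eventually.of_forall fun N => ⟨(P.grid N).pt_nonneg _, (P.grid N).pt_lastIndex_le ht⟩

end RefiningGrids

theorem exists_modulus {f : ℝ → ℝ} {t : ℝ} (hf : ContinuousOn f (Icc 0 t)) {ε : ℝ} (hε : 0 < ε) :
    ∃ δ > 0, ∀ x ∈ Icc 0 t, ∀ y ∈ Icc 0 t, |x - y| < δ → |f x - f y| < ε := by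
  have h := isCompact_Icc.uniformContinuousOn_of_continuous hf
  obtain ⟨δ, hδ, H⟩ := Metric.uniformContinuousOn_iff.1 h ε hε
  exact ⟨δ, hδ, fun x hx y hy hxy => H x hx y hy hxy⟩

theorem exists_abs_le {f : ℝ → ℝ} {t : ℝ} (hf : ContinuousOn f (Icc 0 t)) :
    ∃ K, 0 ≤ K ∧ ∀ x ∈ Icc 0 t, |f x| ≤ K := by
  obtain ⟨K, hK⟩ := isCompact_Icc.exists_bound_of_continuousOn hf
  exact ⟨max K 0, le_max_right _ _, fun x hx => (hK x hx).trans (le_max_left _ _)⟩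

/-! ### Calculus of error arrays along the grids. -/

section Arrays

/-- The array of increments of a path along the grids. -/
def inc (P : RefiningGrids) (X : ℝ → ℝ) (N i : ℕ) : ℝ :=
  X ((P.grid N).pt (i + 1)) - X ((P.grid N).pt i)

/-- The array of values of a path at the left end points of the grid intervals. -/
def val (P : RefiningGrids) (f : ℝ → ℝ) (N i : ℕ) : ℝ := f ((P.grid N).pt i)

/-- The sum of the absolute values of the entries up to time `t` tends to zero. -/
def Negligible (P : RefiningGrids) (t : ℝ) (e : ℕ → ℕ → ℝ) : Prop :=
  Tendsto (fun N => ∑ i ∈ (P.grid N).indices t, |e N i|) atTop (𝓝 0)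

/-- The sum of the absolute values of the entries up to time `t` is bounded. -/
def SumBounded (P : RefiningGrids) (t : ℝ) (e : ℕ → ℕ → ℝ) : Prop :=
  ∃ K, ∀ N, ∑ i ∈ (P.grid N).indices t, |e N i| ≤ K

/-- The entries up to time `t` tend to zero uniformly. -/
def UnifSmall (P : RefiningGrids) (t : ℝ) (e : ℕ → ℕ → ℝ) : Prop :=
  ∀ ε > 0, ∀ᶠ N in atTop, ∀ i ∈ (P.grid N).indices t, |e N i| ≤ ε

/-- The entries up to time `t` are uniformly bounded. -/
def UnifBounded (P : RefiningGrids) (t : ℝ) (e : ℕ → ℕ → ℝ) : Prop :=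
  ∃ K, ∀ N, ∀ i ∈ (P.grid N).indices t, |e N i| ≤ K

variable {P : RefiningGrids} {t : ℝ} {e f : ℕ → ℕ → ℝ} {X : ℝ → ℝ}

theorem Negligible.of_eventually_le (hf : Negligible P t f)
    (h : ∀ᶠ N in atTop, ∀ i ∈ (P.grid N).indices t, |e N i| ≤ |f N i|) : Negligible P t e := by
  refine tendsto_of_tendsto_of_tendsto_of_le_of_le' tendsto_const_nhds hf
    (Eventually.of_forall fun N => Finset.sum_nonneg fun i _ => abs_nonneg _) ?_
  filter_upwards [h] with N hN using Finset.sum_le_sum hN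

theorem Negligible.congr (hf : Negligible P t f)
    (h : ∀ N, ∀ i ∈ (P.grid N).indices t, e N i = f N i) : Negligible P t e :=
  hf.of_eventually_le (Eventually.of_forall fun N i hi => by rw [h N i hi])

theorem Negligible.add (he : Negligible P t e) (hf : Negligible P t f) :
    Negligible P t (fun N i => e N i + f N i) := by
  have h := Tendsto.add he hf
  rw [add_zero] at h
  refine tendsto_of_tendsto_of_tendsto_of_le_of_le tendsto_const_nhds h
    (fun N => Finset.sum_nonneg fun i _ => abs_nonneg _) fun N => ?_
  simp only [← Finset.sum_add_distrib]
  exact Finset.sum_le_sum fun i _ => abs_add_le _ _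

theorem Negligible.neg (he : Negligible P t e) : Negligible P t (fun N i => -e N i) := by
  simpa [Negligible] using he

theorem Negligible.sub (he : Negligible P t e) (hf : Negligible P t f) :
    Negligible P t (fun N i => e N i - f N i) :=
  (he.add hf.neg).congr fun _ _ _ => sub_eq_add_neg _ _

theorem UnifBounded.mul_negligible (he : UnifBounded P t e) (hf : Negligible P t f) :
    Negligible P t (fun N i => e N i * f N i) := by
  obtain ⟨K, hK⟩ := he
  have h := Tendsto.const_mul K hf
  rw [mul_zero] at h
  refine tendsto_of_tendsto_of_tendsto_of_le_of_le tendsto_const_nhds h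
    (fun N => Finset.sum_nonneg fun i _ => abs_nonneg _) fun N => ?_
  simp only [Finset.mul_sum]
  refine Finset.sum_le_sum fun i hi => ?_
  rw [abs_mul]
  exact mul_le_mul_of_nonneg_right (hK N i hi) (abs_nonneg _)

/-- The basic source of negligible arrays: one factor is small by continuity, the other is a squared
increment or an increment of finite variation. -/
theorem UnifSmall.mul_sumBounded (he : UnifSmall P t e) (hf : SumBounded P t f) :
    Negligible P t (fun N i => e N i * f N i) := by
  obtain ⟨K, hK⟩ := hf
  rw [Negligible, Metric.tendsto_nhds]
  intro ε hε
  filter_upwards [he (ε / (|K| + 1)) (by positivity)] with N hN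
  rw [Real.dist_eq, sub_zero, abs_of_nonneg (Finset.sum_nonneg fun i _ => abs_nonneg _)]
  calc ∑ i ∈ (P.grid N).indices t, |e N i * f N i|
      ≤ ∑ i ∈ (P.grid N).indices t, ε / (|K| + 1) * |f N i| := by
        refine Finset.sum_le_sum fun i hi => ?_
        rw [abs_mul]
        exact mul_le_mul_of_nonneg_right (hN i hi) (abs_nonneg _)
    _ ≤ ε / (|K| + 1) * |K| := by
        rw [← Finset.mul_sum]
        exact mul_le_mul_of_nonneg_left ((hK N).trans (le_abs_self K)) (by positivity)
    _ < ε := by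
        rw [div_mul_eq_mul_div, div_lt_iff₀ (by positivity)]
        nlinarith [abs_nonneg K]

theorem SumBounded.mono (hf : SumBounded P t f)
    (h : ∀ N, ∀ i ∈ (P.grid N).indices t, |e N i| ≤ |f N i|) : SumBounded P t e := by
  obtain ⟨K, hK⟩ := hf
  exact ⟨K, fun N => (Finset.sum_le_sum (h N)).trans (hK N)⟩

theorem SumBounded.add (he : SumBounded P t e) (hf : SumBounded P t f) :
    SumBounded P t (fun N i => e N i + f N i) := by
  obtain ⟨K, hK⟩ := he
  obtain ⟨L, hL⟩ := hf
  refine ⟨K + L, fun N => (Finset.sum_le_sum fun i _ => abs_add_le _ _).trans ?_⟩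
  rw [Finset.sum_add_distrib]
  exact add_le_add (hK N) (hL N)

theorem UnifBounded.mul_sumBounded (he : UnifBounded P t e) (hf : SumBounded P t f) :
    SumBounded P t (fun N i => e N i * f N i) := by
  obtain ⟨K, hK⟩ := he
  obtain ⟨L, hL⟩ := hf
  refine ⟨|K| * L, fun N =>
    (Finset.sum_le_sum (g := fun i => |K| * |f N i|) fun i hi => ?_).trans ?_⟩
  · rw [abs_mul]
    exact mul_le_mul_of_nonneg_right ((hK N i hi).trans (le_abs_self K)) (abs_nonneg _)
  · rw [← Finset.mul_sum]
    exact mul_le_mul_of_nonneg_left (hL N) (abs_nonneg K)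

theorem SumBounded.const_mul (c : ℝ) (hf : SumBounded P t f) :
    SumBounded P t (fun N i => c * f N i) :=
  UnifBounded.mul_sumBounded (e := fun _ _ => c) ⟨|c|, fun _ _ _ => le_rfl⟩ hf

theorem SumBounded.sub (he : SumBounded P t e) (hf : SumBounded P t f) :
    SumBounded P t (fun N i => e N i - f N i) :=
  (he.add (hf.const_mul (-1))).mono fun N i _ => by rw [neg_one_mul, sub_eq_add_neg]

theorem Negligible.const_mul (c : ℝ) (hf : Negligible P t f) :
    Negligible P t (fun N i => c * f N i) :=
  UnifBounded.mul_negligible (e := fun _ _ => c) ⟨|c|, fun _ _ _ => le_rfl⟩ hf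

theorem UnifSmall.add (he : UnifSmall P t e) (hf : UnifSmall P t f) :
    UnifSmall P t (fun N i => e N i + f N i) := by
  intro ε hε
  filter_upwards [he (ε / 2) (by positivity), hf (ε / 2) (by positivity)] with N h1 h2 i hi
  have := abs_add_le (e N i) (f N i)
  linarith [h1 i hi, h2 i hi]

theorem UnifBounded.mul_unifSmall (he : UnifBounded P t e) (hf : UnifSmall P t f) :
    UnifSmall P t (fun N i => e N i * f N i) := by
  obtain ⟨K, hK⟩ := he
  intro ε hε
  filter_upwards [hf (ε / (|K| + 1)) (by positivity)] with N hN i hi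
  rw [abs_mul]
  calc |e N i| * |f N i| ≤ (|K| + 1) * (ε / (|K| + 1)) :=
        mul_le_mul ((hK N i hi).trans (by linarith [le_abs_self K])) (hN i hi) (abs_nonneg _)
          (by positivity)
    _ = ε := by field_simp

theorem UnifSmall.const_mul (c : ℝ) (hf : UnifSmall P t f) :
    UnifSmall P t (fun N i => c * f N i) :=
  UnifBounded.mul_unifSmall (e := fun _ _ => c) ⟨|c|, fun _ _ _ => le_rfl⟩ hf

theorem UnifBounded.mul (he : UnifBounded P t e) (hf : UnifBounded P t f) :
    UnifBounded P t (fun N i => e N i * f N i) := by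
  obtain ⟨K, hK⟩ := he
  obtain ⟨L, hL⟩ := hf
  refine ⟨|K| * |L|, fun N i hi => ?_⟩
  rw [abs_mul]
  exact mul_le_mul ((hK N i hi).trans (le_abs_self K)) ((hL N i hi).trans (le_abs_self L))
    (abs_nonneg _) (abs_nonneg _)

theorem unifBounded_const (c : ℝ) : UnifBounded P t (fun _ _ => c) := ⟨|c|, fun _ _ _ => le_rfl⟩

theorem unifBounded_val (hX : ContinuousOn X (Icc 0 t)) : UnifBounded P t (val P X) := by
  obtain ⟨K, _, hK⟩ := exists_abs_le hX
  exact ⟨K, fun N i hi => hK _ (TimeGrid.pt_mem_Icc hi)⟩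

theorem unifSmall_inc (hX : ContinuousOn X (Icc 0 t)) : UnifSmall P t (inc P X) := by
  intro ε hε
  obtain ⟨δ, hδ, H⟩ := exists_modulus hX hε
  filter_upwards [P.eventually_step_lt hδ] with N hN i hi
  refine (H _ (TimeGrid.pt_succ_mem_Icc hi) _ (TimeGrid.pt_mem_Icc hi) ?_).le
  rw [abs_of_nonneg (sub_nonneg.2 ((P.grid N).pt_le_pt_succ i))]
  exact hN i

theorem unifBounded_inc (hX : ContinuousOn X (Icc 0 t)) : UnifBounded P t (inc P X) := by
  obtain ⟨K, _, hK⟩ := exists_abs_le hX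
  refine ⟨K + K, fun N i hi => ?_⟩
  exact (abs_sub _ _).trans (add_le_add (hK _ (TimeGrid.pt_succ_mem_Icc hi))
    (hK _ (TimeGrid.pt_mem_Icc hi)))

/-- A path whose increments on `[0, t]` are dominated by those of a monotone function has
summable increments along the grids. -/
theorem sumBounded_inc {V : ℝ → ℝ} (ht : 0 ≤ t)
    (hV : ∀ u ∈ Icc 0 t, ∀ v ∈ Icc 0 t, u ≤ v → |X v - X u| ≤ V v - V u) :
    SumBounded P t (inc P X) := by
  refine ⟨V t - V 0, fun N => ?_⟩
  have h1 : ∑ i ∈ (P.grid N).indices t, |inc P X N i| ≤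
      ∑ i ∈ (P.grid N).indices t, (V ((P.grid N).pt (i + 1)) - V ((P.grid N).pt i)) :=
    Finset.sum_le_sum fun i hi => hV _ (TimeGrid.pt_mem_Icc hi) _ (TimeGrid.pt_succ_mem_Icc hi)
      ((P.grid N).pt_le_pt_succ i)
  rw [TimeGrid.sum_indices_sub] at h1
  have h2 := hV _ ⟨(P.grid N).pt_nonneg _, (P.grid N).pt_lastIndex_le ht⟩ t ⟨ht, le_rfl⟩
    ((P.grid N).pt_lastIndex_le ht)
  linarith [abs_nonneg (X t - X ((P.grid N).pt ((P.grid N).lastIndex t)))]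

theorem sumBounded_of_tendsto (he : ∀ N i, 0 ≤ e N i) {q : ℝ}
    (h : Tendsto (fun N => ∑ i ∈ (P.grid N).indices t, e N i) atTop (𝓝 q)) :
    SumBounded P t e := by
  obtain ⟨K, hK⟩ := h.bddAbove_range
  refine ⟨K, fun N => ?_⟩
  simp only [abs_of_nonneg (he _ _)]
  exact hK ⟨N, rfl⟩

theorem Negligible.tendsto_sum (he : Negligible P t e) :
    Tendsto (fun N => ∑ i ∈ (P.grid N).indices t, e N i) atTop (𝓝 0) :=
  squeeze_zero_norm (fun _ => Finset.abs_sum_le_sum_abs _ _) he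

theorem tendsto_sum_inc (ht : 0 ≤ t) (hX : ContinuousOn X (Icc 0 t)) :
    Tendsto (fun N => ∑ i ∈ (P.grid N).indices t, inc P X N i) atTop (𝓝 (X t - X 0)) := by
  simp only [inc, TimeGrid.sum_indices_sub]
  exact (P.tendsto_apply_lastPt ht hX).sub_const _

/-- The cubic remainder is written as `|x| * x ^ 2` to fit the pattern uniformly small times
summable. -/
theorem abs_exp_sub_quadratic_le {x : ℝ} (hx : |x| ≤ 1) :
    |Real.exp x - 1 - x - x ^ 2 / 2| ≤ |x| * x ^ 2 := by
  -- The constant supplied for `n = 3` is 2/9, which is weakened to 1.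
  have h := Real.exp_bound hx (n := 3) (by norm_num)
  simp only [Finset.sum_range_succ, Finset.sum_range_zero] at h
  norm_num at h
  have h1 : |Real.exp x - 1 - x - x ^ 2 / 2| = |Real.exp x - (1 + x + x ^ 2 / 2)| := by
    congr 1; ring
  rw [h1]
  refine h.trans ?_
  have : |x| ^ 3 = |x| * x ^ 2 := by rw [pow_succ, sq_abs]; ring
  rw [this]
  have : 0 ≤ |x| * x ^ 2 := by positivity
  linarith

theorem negligible_exp_quadratic (he : UnifSmall P t e) (he2 : SumBounded P t fun N i => e N i ^ 2) :
    Negligible P t fun N i => Real.exp (e N i) - 1 - e N i - e N i ^ 2 / 2 := by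
  refine (he.mul_sumBounded he2).of_eventually_le ?_
  filter_upwards [he 1 one_pos] with N hN i hi
  rw [abs_mul, abs_of_nonneg (sq_nonneg (e N i))]
  exact abs_exp_sub_quadratic_le (hN i hi)

theorem negligible_exp_linear (he : UnifSmall P t e) (he1 : SumBounded P t e) :
    Negligible P t fun N i => Real.exp (e N i) - 1 - e N i := by
  refine (he.mul_sumBounded he1).of_eventually_le ?_
  filter_upwards [he 1 one_pos] with N hN i hi
  rw [← sq, abs_of_nonneg (sq_nonneg (e N i))]
  exact Real.abs_exp_sub_one_sub_id_le (hN i hi)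

end Arrays

/-! ### From convergence of partial sums to convergence of weighted sums. -/

section WeakConvergence

variable {P : RefiningGrids} {t : ℝ} {f : ℝ → ℝ} {ρ : ℕ → ℕ → ℝ}

/-- The step function takes the value of `f` at the last grid point. Writing it as a sum of jumps,
the `k`-th at time `t_{k+1}`, prepares summation by parts. -/
theorem exists_step_approx (P : RefiningGrids) (hf : ContinuousOn f (Icc 0 t))
    {ε : ℝ} (hε : 0 < ε) :
    ∃ M, ∀ s ∈ Icc 0 t, |f s - (f 0 + ∑ k ∈ (P.grid M).indices s, inc P f M k)| ≤ ε := by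
  obtain ⟨δ, hδ, H⟩ := exists_modulus hf hε
  obtain ⟨M, hM⟩ := (P.eventually_step_lt hδ).exists
  refine ⟨M, fun s hs => ?_⟩
  simp only [inc, TimeGrid.sum_indices_sub]
  have h1 := (P.grid M).pt_lastIndex_le hs.1
  have h2 := (P.grid M).lt_pt_lastIndex_succ s
  have h3 := hM ((P.grid M).lastIndex s)
  rw [add_sub_cancel]
  refine (H s hs _ ⟨(P.grid M).pt_nonneg _, h1.trans hs.2⟩ ?_).le
  rw [abs_lt]
  constructor <;> linarith

/-- By nestedness a coarse grid point is also a fine one, so cutting the fine sum there leaves no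
partial interval. -/
theorem sum_filter_pt_le (P : RefiningGrids) {M N k : ℕ} (h : M ≤ N)
    (hk : (P.grid M).pt k ≤ t) (a : ℕ → ℝ) :
    ∑ i ∈ (P.grid N).indices t with (P.grid M).pt k ≤ (P.grid N).pt i, a i =
      ∑ i ∈ (P.grid N).indices t, a i - ∑ i ∈ (P.grid N).indices ((P.grid M).pt k), a i := by
  obtain ⟨j, hj⟩ := P.exists_pt_eq h k
  have hsub : (P.grid N).indices ((P.grid M).pt k) =
      {i ∈ (P.grid N).indices t | ¬ (P.grid M).pt k ≤ (P.grid N).pt i} := by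
    ext i
    rw [Finset.mem_filter, TimeGrid.mem_indices, TimeGrid.mem_indices, ← hj, not_le,
      (P.grid N).strictMono.le_iff_le, (P.grid N).strictMono.lt_iff_lt]
    constructor
    · intro h1
      exact ⟨((P.grid N).pt_mono h1).trans (hj ▸ hk), by omega⟩
    · rintro ⟨_, h1⟩
      omega
  rw [hsub, ← Finset.sum_filter_add_sum_filter_not ((P.grid N).indices t)
    (fun i => (P.grid M).pt k ≤ (P.grid N).pt i)]
  ring

/-- After `f` is replaced by a step function on one fixed coarse grid, interchanging the sums leaves
only sums of `ρ` up to finitely many times that do not depend on `N`. The replacement costs the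
uniform error times the bound for the sums of `|ρ|`. -/
theorem exists_abel_approx (hf : ContinuousOn f (Icc 0 t)) (hρ : SumBounded P t ρ)
    {ε : ℝ} (hε : 0 < ε) :
    ∃ M, ∀ N ≥ M, |∑ i ∈ (P.grid N).indices t, val P f N i * ρ N i -
      (f 0 * ∑ i ∈ (P.grid N).indices t, ρ N i +
        ∑ k ∈ (P.grid M).indices t, inc P f M k * (∑ i ∈ (P.grid N).indices t, ρ N i -
          ∑ i ∈ (P.grid N).indices ((P.grid M).pt (k + 1)), ρ N i))| ≤ ε := by
  obtain ⟨K, hK⟩ := hρ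
  obtain ⟨M, hM⟩ := exists_step_approx P hf (ε := ε / (|K| + 1)) (by positivity)
  refine ⟨M, fun N hN => ?_⟩
  have h1 : ∑ k ∈ (P.grid M).indices t, inc P f M k * (∑ i ∈ (P.grid N).indices t, ρ N i -
      ∑ i ∈ (P.grid N).indices ((P.grid M).pt (k + 1)), ρ N i) =
      ∑ i ∈ (P.grid N).indices t,
        (∑ k ∈ (P.grid M).indices ((P.grid N).pt i), inc P f M k) * ρ N i := by
    have h2 : ∀ i ∈ (P.grid N).indices t, (P.grid M).indices ((P.grid N).pt i) =
        {k ∈ (P.grid M).indices t | (P.grid M).pt (k + 1) ≤ (P.grid N).pt i} := by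
      intro i hi
      ext k
      rw [Finset.mem_filter, TimeGrid.mem_indices, TimeGrid.mem_indices]
      exact ⟨fun h => ⟨h.trans (TimeGrid.pt_mem_Icc hi).2, h⟩, fun h => h.2⟩
    have h3 : ∀ i ∈ (P.grid N).indices t,
        (∑ k ∈ (P.grid M).indices ((P.grid N).pt i), inc P f M k) * ρ N i =
        ∑ k ∈ (P.grid M).indices t,
          (if (P.grid M).pt (k + 1) ≤ (P.grid N).pt i then inc P f M k else 0) * ρ N i := by
      intro i hi
      rw [h2 i hi, Finset.sum_filter, Finset.sum_mul]
    rw [Finset.sum_congr rfl h3, Finset.sum_comm]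
    refine Finset.sum_congr rfl fun k hk => ?_
    rw [← sum_filter_pt_le P hN (TimeGrid.mem_indices.1 hk), Finset.sum_filter, Finset.mul_sum]
    refine Finset.sum_congr rfl fun i _ => ?_
    split_ifs <;> simp
  rw [h1, Finset.mul_sum, ← Finset.sum_add_distrib, ← Finset.sum_sub_distrib]
  calc |∑ i ∈ (P.grid N).indices t, (val P f N i * ρ N i - (f 0 * ρ N i +
        (∑ k ∈ (P.grid M).indices ((P.grid N).pt i), inc P f M k) * ρ N i))|
      ≤ ∑ i ∈ (P.grid N).indices t, ε / (|K| + 1) * |ρ N i| := by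
        refine (Finset.abs_sum_le_sum_abs _ _).trans (Finset.sum_le_sum fun i hi => ?_)
        rw [← add_mul, ← sub_mul, abs_mul]
        exact mul_le_mul_of_nonneg_right (hM _ (TimeGrid.pt_mem_Icc hi)) (abs_nonneg _)
    _ ≤ ε / (|K| + 1) * (|K| + 1) := by
        rw [← Finset.mul_sum]
        exact mul_le_mul_of_nonneg_left ((hK N).trans (by linarith [le_abs_self K]))
          (by positivity)
    _ = ε := by field_simp

/-- If the sums of an array converge up to every time, then so do its sums against a
continuous function. -/
theorem exists_tendsto_sum_val_mul (ht : 0 ≤ t) (hf : ContinuousOn f (Icc 0 t))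
    (hρ : SumBounded P t ρ) {Q : ℝ → ℝ}
    (hQ : ∀ s ∈ Icc 0 t, Tendsto (fun N => ∑ i ∈ (P.grid N).indices s, ρ N i) atTop (𝓝 (Q s))) :
    ∃ l, Tendsto (fun N => ∑ i ∈ (P.grid N).indices t, val P f N i * ρ N i) atTop (𝓝 l) := by
  refine cauchySeq_tendsto_of_complete (Metric.cauchySeq_iff'.2 fun ε hε => ?_)
  obtain ⟨M, hM⟩ := exists_abel_approx hf hρ (ε := ε / 5) (by positivity)
  have hb := ((hQ t ⟨ht, le_rfl⟩).const_mul (f 0)).add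
    (tendsto_finsetSum ((P.grid M).indices t) fun k hk => (((hQ t ⟨ht, le_rfl⟩).sub
      (hQ _ (TimeGrid.pt_succ_mem_Icc hk))).const_mul (inc P f M k)))
  obtain ⟨N₀, hN₀⟩ := Metric.cauchySeq_iff.1 hb.cauchySeq (ε / 5) (by positivity)
  refine ⟨max M N₀, fun N hN => ?_⟩
  have h1 := hM N ((le_max_left _ _).trans hN)
  have h2 := hM (max M N₀) (le_max_left _ _)
  have h3 := hN₀ N ((le_max_right _ _).trans hN) (max M N₀) (le_max_right _ _)
  rw [Real.dist_eq] at h3 ⊢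
  rw [abs_le] at h1 h2
  rw [abs_lt] at h3 ⊢
  constructor <;> linarith [h1.1, h1.2, h2.1, h2.2, h3.1, h3.2]

/-- If the sums of an array tend to zero up to every time, then so do its sums against a
continuous function. -/
theorem tendsto_sum_val_mul_zero (ht : 0 ≤ t) (hf : ContinuousOn f (Icc 0 t))
    (hρ : SumBounded P t ρ)
    (hQ : ∀ s ∈ Icc 0 t, Tendsto (fun N => ∑ i ∈ (P.grid N).indices s, ρ N i) atTop (𝓝 0)) :
    Tendsto (fun N => ∑ i ∈ (P.grid N).indices t, val P f N i * ρ N i) atTop (𝓝 0) := by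
  rw [Metric.tendsto_nhds]
  intro ε hε
  obtain ⟨M, hM⟩ := exists_abel_approx hf hρ (ε := ε / 2) (by positivity)
  have hb := ((hQ t ⟨ht, le_rfl⟩).const_mul (f 0)).add
    (tendsto_finsetSum ((P.grid M).indices t) fun k hk => (((hQ t ⟨ht, le_rfl⟩).sub
      (hQ _ (TimeGrid.pt_succ_mem_Icc hk))).const_mul (inc P f M k)))
  simp only [mul_zero, sub_zero, Finset.sum_const_zero, add_zero] at hb
  filter_upwards [eventually_ge_atTop M, Metric.tendsto_nhds.1 hb (ε / 2) (by positivity)]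
    with N hN h2
  have h1 := hM N hN
  rw [Real.dist_eq, sub_zero, abs_lt] at h2 ⊢
  rw [abs_le] at h1
  constructor <;> linarith [h1.1, h1.2, h2.1, h2.2]

end WeakConvergence

/-! ### Quadratic variation as a limit for all times `t ≥ 0`. -/

section QuadVar

variable {P : RefiningGrids} {X : ℝ → ℝ} {t : ℝ}

theorem quadVarSum_zero (P : RefiningGrids) (X : ℝ → ℝ) (N : ℕ) : quadVarSum P X 0 N = 0 := by
  have : (P.grid N).indices 0 = ∅ := by
    have h := (P.grid N).indices_pt 0
    rwa [(P.grid N).pt_zero] at h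
  simp [quadVarSum, this]

theorem quadVar_zero (P : RefiningGrids) (X : ℝ → ℝ) : quadVar P X 0 = 0 :=
  Tendsto.limUnder_eq (by simp [funext (quadVarSum_zero P X)])

/-- Assuming only the existence of limits makes this usable for `log S` before the continuity of its
quadratic variation is known. -/
theorem tendsto_quadVar (h : ∀ s, 0 < s → ∃ q, Tendsto (quadVarSum P X s) atTop (𝓝 q))
    (ht : 0 ≤ t) : Tendsto (quadVarSum P X t) atTop (𝓝 (quadVar P X t)) := by
  rcases ht.eq_or_lt with rfl | ht
  · rw [quadVar_zero, funext (quadVarSum_zero P X)]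
    exact tendsto_const_nhds
  · exact tendsto_nhds_limUnder (h t ht)

theorem HasContinuousQuadVar.tendsto (h : HasContinuousQuadVar P X) (ht : 0 ≤ t) :
    Tendsto (fun N => ∑ i ∈ (P.grid N).indices t, inc P X N i ^ 2) atTop
      (𝓝 (quadVar P X t)) :=
  tendsto_quadVar h.1 ht

theorem HasContinuousQuadVar.continuousOn_Icc (h : HasContinuousQuadVar P X) :
    ContinuousOn (quadVar P X) (Icc 0 t) := h.2.mono Icc_subset_Ici_self

theorem HasContinuousQuadVar.sumBounded (h : HasContinuousQuadVar P X) (ht : 0 ≤ t) :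
    SumBounded P t fun N i => inc P X N i ^ 2 :=
  sumBounded_of_tendsto (fun _ _ => sq_nonneg _) (h.tendsto ht)

theorem HasContinuousQuadVar.mono (h : HasContinuousQuadVar P X) {u v : ℝ} (hu : 0 ≤ u)
    (huv : u ≤ v) : quadVar P X u ≤ quadVar P X v :=
  le_of_tendsto_of_tendsto' (h.tendsto hu) (h.tendsto (hu.trans huv)) fun N =>
    Finset.sum_le_sum_of_subset_of_nonneg ((P.grid N).indices_mono huv) fun _ _ _ => sq_nonneg _

theorem HasContinuousQuadVar.sumBounded_inc (h : HasContinuousQuadVar P X) (ht : 0 ≤ t) :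
    SumBounded P t (inc P (quadVar P X)) :=
  PathwiseCPPI.sumBounded_inc (V := quadVar P X) ht fun _ hu _ _ huv =>
    (abs_of_nonneg (sub_nonneg.2 (h.mono hu.1 huv))).le

/-- The squared increments and the increments of the quadratic variation have the same sums
against continuous functions. -/
theorem HasContinuousQuadVar.tendsto_sum_val_mul (h : HasContinuousQuadVar P X) (ht : 0 ≤ t)
    {f : ℝ → ℝ} (hf : ContinuousOn f (Icc 0 t)) :
    Tendsto (fun N => ∑ i ∈ (P.grid N).indices t,
      val P f N i * (inc P X N i ^ 2 - inc P (quadVar P X) N i)) atTop (𝓝 0) := by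
  refine tendsto_sum_val_mul_zero ht hf ((h.sumBounded ht).sub (h.sumBounded_inc ht))
    fun s hs => ?_
  have h1 := (h.tendsto hs.1).sub (tendsto_sum_inc (P := P) hs.1 (h.continuousOn_Icc (t := s)))
  simpa [Finset.sum_sub_distrib, quadVar_zero] using h1

end QuadVar

/-! ### Quadratic variation of the logarithm. -/

section Log

variable {P : RefiningGrids} {S : ℝ → ℝ} {t : ℝ}

/-- The inequality `log z ≤ z - 1`, applied to `y / x` and to `x / y`, traps the logarithmic
increment between `y⁻¹ (y - x)` and `x⁻¹ (y - x)`. -/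
theorem abs_log_sub_sub_le {x y : ℝ} (hx : 0 < x) (hy : 0 < y) :
    |Real.log y - Real.log x - x⁻¹ * (y - x)| ≤ |y⁻¹ - x⁻¹| * |y - x| := by
  have h1 : Real.log y - Real.log x ≤ x⁻¹ * (y - x) := by
    rw [← Real.log_div hy.ne' hx.ne']
    refine (Real.log_le_sub_one_of_pos (by positivity)).trans_eq ?_
    field_simp
  have h2 : y⁻¹ * (y - x) ≤ Real.log y - Real.log x := by
    rw [← neg_sub (Real.log x), ← Real.log_div hx.ne' hy.ne', le_neg]
    refine (Real.log_le_sub_one_of_pos (by positivity)).trans_eq ?_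
    field_simp
    ring
  rw [← abs_mul, sub_mul]
  rw [abs_sub_comm, abs_of_nonneg (by linarith)]
  refine le_trans ?_ (neg_le_abs _)
  linarith

theorem continuousOn_log_comp (hS_cont : ContinuousOn S (Ici 0)) (hS_pos : ∀ t, 0 ≤ t → 0 < S t) :
    ContinuousOn (fun s => Real.log (S s)) (Ici 0) :=
  hS_cont.log fun s hs => (hS_pos s hs).ne'

theorem continuousOn_inv_comp (hS_cont : ContinuousOn S (Ici 0)) (hS_pos : ∀ t, 0 ≤ t → 0 < S t) :
    ContinuousOn (fun s => (S s)⁻¹) (Ici 0) :=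
  hS_cont.inv₀ fun s hs => (hS_pos s hs).ne'

/-- With `d` the error of the linear approximation, the difference of squares factors as `d (2 S⁻¹
ΔS + d)`. Since `|d| ≤ |Δ(S⁻¹)| |ΔS|`, it is a uniformly small array times `(ΔS)²`. -/
theorem negligible_sq_inc_log (hS_cont : ContinuousOn S (Ici 0))
    (hS_pos : ∀ t, 0 ≤ t → 0 < S t) (hS_qv : HasContinuousQuadVar P S) (ht : 0 ≤ t) :
    Negligible P t fun N i => inc P (fun s => Real.log (S s)) N i ^ 2 -
      val P (fun s => (S s)⁻¹ ^ 2) N i * inc P S N i ^ 2 := by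
  have hc : ContinuousOn (fun s => (S s)⁻¹) (Icc 0 t) :=
    (continuousOn_inv_comp hS_cont hS_pos).mono Icc_subset_Ici_self
  have hb : UnifBounded P t fun N i => 2 * |(S ((P.grid N).pt i))⁻¹| +
      |inc P (fun s => (S s)⁻¹) N i| := by
    obtain ⟨K, hK⟩ := unifBounded_val (P := P) hc
    obtain ⟨L, hL⟩ := unifBounded_inc (P := P) hc
    refine ⟨2 * K + L, fun N i hi => ?_⟩
    rw [abs_of_nonneg (by positivity)]
    exact add_le_add (mul_le_mul_of_nonneg_left (hK N i hi) (by norm_num)) (hL N i hi)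
  refine ((hb.mul_unifSmall (unifSmall_inc hc)).mul_sumBounded
    (hS_qv.sumBounded ht)).of_eventually_le (Eventually.of_forall fun N i hi => ?_)
  simp only [inc, val]
  set x := S ((P.grid N).pt i)
  set y := S ((P.grid N).pt (i + 1))
  have hd := abs_log_sub_sub_le (hS_pos _ ((P.grid N).pt_nonneg i))
    (hS_pos _ ((P.grid N).pt_nonneg (i + 1)))
  set d := Real.log y - Real.log x - x⁻¹ * (y - x)
  have h1 : (Real.log y - Real.log x) ^ 2 - x⁻¹ ^ 2 * (y - x) ^ 2 =
      d * (2 * (x⁻¹ * (y - x)) + d) := by simp only [d]; ring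
  rw [h1, abs_mul, abs_mul, abs_mul, abs_of_nonneg (sq_nonneg (y - x)), ← sq_abs (y - x)]
  rw [abs_of_nonneg (by positivity : (0 : ℝ) ≤ 2 * |x⁻¹| + |y⁻¹ - x⁻¹|)]
  calc |d| * |2 * (x⁻¹ * (y - x)) + d|
      ≤ (|y⁻¹ - x⁻¹| * |y - x|) * (2 * (|x⁻¹| * |y - x|) + |y⁻¹ - x⁻¹| * |y - x|) := by
        refine mul_le_mul hd ((abs_add_le _ _).trans (add_le_add ?_ hd)) (abs_nonneg _)
          (by positivity)
        rw [abs_mul, abs_mul, abs_two]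
    _ = _ := by ring

/-- Existence comes from weighting `(ΔS)²` by the continuous function `S⁻²`. Continuity comes from
comparison: increments of `[log S]` are locally at most a constant times those of `[S]`. -/
theorem hasContinuousQuadVar_log (hS_cont : ContinuousOn S (Ici 0))
    (hS_pos : ∀ t, 0 ≤ t → 0 < S t) (hS_qv : HasContinuousQuadVar P S) :
    HasContinuousQuadVar P fun s => Real.log (S s) := by
  have hlim : ∀ t, 0 < t →
      ∃ q, Tendsto (quadVarSum P (fun s => Real.log (S s)) t) atTop (𝓝 q) := by
    intro t ht
    have hc : ContinuousOn (fun s => (S s)⁻¹ ^ 2) (Icc 0 t) :=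
      ((continuousOn_inv_comp hS_cont hS_pos).mono Icc_subset_Ici_self).pow 2
    obtain ⟨l, hl⟩ := exists_tendsto_sum_val_mul ht.le hc (hS_qv.sumBounded ht.le)
      fun s hs => hS_qv.tendsto hs.1
    refine ⟨l, ?_⟩
    have h := (negligible_sq_inc_log hS_cont hS_pos hS_qv ht.le).tendsto_sum.add hl
    rw [zero_add] at h
    refine h.congr fun N => ?_
    rw [← Finset.sum_add_distrib]
    exact Finset.sum_congr rfl fun i _ => by simp [val, inc]
  refine ⟨hlim, ?_⟩
  intro x hx
  obtain ⟨K, hK0, hK⟩ := exists_abs_le (t := x + 1)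
    ((continuousOn_inv_comp hS_cont hS_pos).mono Icc_subset_Ici_self)
  have hstep : ∀ N, ∀ i ∈ (P.grid N).indices (x + 1),
      inc P (fun s => Real.log (S s)) N i ^ 2 ≤ (3 * K) ^ 2 * inc P S N i ^ 2 := by
    intro N i hi
    have hd := abs_log_sub_sub_le (hS_pos _ ((P.grid N).pt_nonneg i))
      (hS_pos _ ((P.grid N).pt_nonneg (i + 1)))
    have h1 := hK _ (TimeGrid.pt_mem_Icc hi)
    have h2 := hK _ (TimeGrid.pt_succ_mem_Icc hi)
    simp only [inc]
    set a := (S ((P.grid N).pt i))⁻¹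
    set b := (S ((P.grid N).pt (i + 1)))⁻¹
    set s := S ((P.grid N).pt (i + 1)) - S ((P.grid N).pt i)
    set l := Real.log (S ((P.grid N).pt (i + 1))) - Real.log (S ((P.grid N).pt i))
    -- The constant is `2K` from `|b - a|` plus `K` from `|a|`.
    have h3 : |l| ≤ 3 * K * |s| := by
      have h4 : |l| ≤ |l - a * s| + |a * s| := by
        simpa using abs_add_le (l - a * s) (a * s)
      rw [abs_mul] at h4
      have h5 := mul_le_mul_of_nonneg_right h1 (abs_nonneg s)
      have h6 := mul_le_mul_of_nonneg_right ((abs_sub b a).trans (add_le_add h2 h1)) (abs_nonneg s)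
      linarith
    calc l ^ 2 = |l| ^ 2 := (sq_abs l).symm
      _ ≤ (3 * K * |s|) ^ 2 := by gcongr
      _ = _ := by rw [mul_pow, sq_abs]
  have hmono : ∀ u v, 0 ≤ u → u ≤ v → v ≤ x + 1 →
      |quadVar P (fun s => Real.log (S s)) v - quadVar P (fun s => Real.log (S s)) u| ≤
        (3 * K) ^ 2 * (quadVar P S v - quadVar P S u) := by
    intro u v hu huv hv
    have hl := (tendsto_quadVar hlim (hu.trans huv)).sub (tendsto_quadVar hlim hu)
    have hq := ((hS_qv.tendsto (hu.trans huv)).sub (hS_qv.tendsto hu)).const_mul ((3 * K) ^ 2)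
    refine le_of_tendsto_of_tendsto' hl.abs hq fun N => ?_
    simp only [quadVarSum]
    rw [← Finset.sum_sdiff_eq_sub ((P.grid N).indices_mono huv),
      ← Finset.sum_sdiff_eq_sub ((P.grid N).indices_mono huv), Finset.mul_sum,
      abs_of_nonneg (Finset.sum_nonneg fun _ _ => sq_nonneg _)]
    exact Finset.sum_le_sum fun i hi =>
      hstep N i ((P.grid N).indices_mono hv (Finset.mem_sdiff.1 hi).1)
  have hq : Tendsto (fun y => (3 * K) ^ 2 * |quadVar P S y - quadVar P S x|) (𝓝[Ici 0] x)
      (𝓝 0) := by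
    have := (((hS_qv.2 x hx).sub_const (quadVar P S x)).abs).const_mul ((3 * K) ^ 2)
    simpa using this
  rw [ContinuousWithinAt, tendsto_iff_norm_sub_tendsto_zero]
  refine tendsto_of_tendsto_of_tendsto_of_le_of_le' tendsto_const_nhds hq
    (Eventually.of_forall fun _ => norm_nonneg _) ?_
  filter_upwards [self_mem_nhdsWithin, mem_nhdsWithin_of_mem_nhds (Iio_mem_nhds (lt_add_one x))]
    with y hy hy1
  rw [Real.norm_eq_abs]
  rcases le_total x y with hxy | hxy
  · exact (hmono x y hx hxy hy1.le).trans
      (mul_le_mul_of_nonneg_left (le_abs_self _) (by positivity))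
  · rw [abs_sub_comm, abs_sub_comm (quadVar P S y)]
    exact (hmono y x hy hxy (by linarith)).trans
      (mul_le_mul_of_nonneg_left (le_abs_self _) (by positivity))

end Log

/-! ### Stieltjes integrals as limits of left Riemann sums. -/

section Stieltjes

variable {P : RefiningGrids} {η F : ℝ → ℝ} {t : ℝ}

instance isFiniteMeasure_variation {Ω : Type*} [MeasurableSpace Ω] (μ : SignedMeasure Ω) :
    IsFiniteMeasure (VectorMeasure.variation μ) := by
  rw [← SignedMeasure.totalVariation_eq_variation, SignedMeasure.totalVariation]
  infer_instance

/-- Every variation sum is bounded by a telescoping sum of `V`, whose monotonicity is forced by the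
domination itself. -/
theorem boundedVariationOn_of_abs_sub_le {V : ℝ → ℝ} (ht : 0 ≤ t)
    (hV : ∀ u ∈ Icc 0 t, ∀ v ∈ Icc 0 t, u ≤ v → |F v - F u| ≤ V v - V u) :
    BoundedVariationOn F (Icc 0 t) := by
  have hmono : MonotoneOn V (Icc 0 t) := fun u hu v hv huv => by
    linarith [hV u hu v hv huv, abs_nonneg (F v - F u)]
  refine ne_top_of_le_ne_top (b := ENNReal.ofReal (V t - V 0)) ENNReal.ofReal_ne_top
    (iSup_le ?_)
  rintro ⟨n, u, hu, hut⟩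
  calc ∑ i ∈ Finset.range n, edist (F (u (i + 1))) (F (u i))
      ≤ ∑ i ∈ Finset.range n, ENNReal.ofReal (V (u (i + 1)) - V (u i)) := by
        refine Finset.sum_le_sum fun i _ => ?_
        rw [edist_dist, Real.dist_eq]
        exact ENNReal.ofReal_le_ofReal (hV _ (hut _) _ (hut _) (hu i.le_succ))
    _ = ENNReal.ofReal (V (u n) - V (u 0)) := by
        rw [← ENNReal.ofReal_sum_of_nonneg fun i _ =>
          sub_nonneg.2 (hmono (hut _) (hut _) (hu i.le_succ)), Finset.sum_range_sub fun i => V (u i)]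
    _ ≤ ENNReal.ofReal (V t - V 0) := by
        refine ENNReal.ofReal_le_ofReal (sub_le_sub ?_ ?_)
        · exact hmono (hut n) ⟨ht, le_rfl⟩ (hut n).2
        · exact hmono ⟨le_rfl, ht⟩ (hut 0) (hut 0).1

theorem clamp_mem (ht : 0 ≤ t) (s : ℝ) : max 0 (min s t) ∈ Icc 0 t :=
  ⟨le_max_left _ _, max_le ht (min_le_right _ _)⟩

theorem stopped_of_mem {s : ℝ} (hs : s ∈ Icc 0 t) : stopped F t s = F s := by
  rw [stopped, min_eq_left hs.2, max_eq_right hs.1]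

theorem continuous_stopped (ht : 0 ≤ t) (hF : ContinuousOn F (Icc 0 t)) :
    Continuous (stopped F t) :=
  hF.comp_continuous (by fun_prop) (clamp_mem ht)

theorem boundedVariationOn_stopped (ht : 0 ≤ t) (hF : BoundedVariationOn F (Icc 0 t)) :
    BoundedVariationOn (stopped F t) univ :=
  ne_top_of_le_ne_top hF (eVariationOn.comp_le_of_monotoneOn F (fun s => max 0 (min s t))
    (fun _ _ _ _ h => max_le_max le_rfl (min_le_min h le_rfl)) fun s _ => clamp_mem ht s)

theorem vectorMeasure_Ioc_stopped (ht : 0 ≤ t) (hF : ContinuousOn F (Icc 0 t))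
    (hBV : BoundedVariationOn (stopped F t) univ) {a b : ℝ} (ha : 0 ≤ a) (hab : a ≤ b)
    (hb : b ≤ t) : hBV.vectorMeasure (Ioc a b) = F b - F a := by
  have hc := continuous_stopped ht hF
  have hlim : ∀ s, Function.rightLim (stopped F t) s = stopped F t s := fun s =>
    (hc.continuousAt (x := s)).continuousWithinAt.rightLim_eq
  rw [hBV.vectorMeasure_Ioc hab, hlim, hlim, stopped_of_mem ⟨ha.trans hab, hb⟩,
    stopped_of_mem ⟨ha, hab.trans hb⟩]

theorem integrableOn_vectorMeasure (hη : ContinuousOn η (Icc 0 t))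
    (hBV : BoundedVariationOn (stopped F t) univ) {a b : ℝ} (ha : 0 ≤ a) (hb : b ≤ t) :
    hBV.vectorMeasure.IntegrableOn η (Ioc a b) := by
  have h1 : IntegrableOn η (Icc 0 t) hBV.vectorMeasure.variation :=
    hη.integrableOn_compact isCompact_Icc
  have h2 := h1.mono_set (fun s (hs : s ∈ Ioc a b) => ⟨ha.trans hs.1.le, hs.2.trans hb⟩)
  rwa [VectorMeasure.IntegrableOn, VectorMeasure.Integrable,
    VectorMeasure.variation_restrict measurableSet_Ioc]

/-- Local error of a Riemann sum: oscillation of the integrand times variation of the integrator. -/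
theorem abs_setIntegral_sub_le (ht : 0 ≤ t) (hη : ContinuousOn η (Icc 0 t))
    (hF : ContinuousOn F (Icc 0 t)) (hBV : BoundedVariationOn (stopped F t) univ) {a b c ε : ℝ}
    (ha : 0 ≤ a) (hab : a ≤ b) (hb : b ≤ t) (hc : ∀ s ∈ Ioc a b, |η s - c| ≤ ε) :
    |(∫ᵛ s in Ioc a b, η s ∂•hBV.vectorMeasure) - c * (F b - F a)| ≤
      ε * hBV.vectorMeasure.variation.real (Ioc a b) := by
  have h1 : (∫ᵛ _ in Ioc a b, c ∂•hBV.vectorMeasure) = c * (F b - F a) := by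
    rw [VectorMeasure.setIntegral_const, vectorMeasure_Ioc_stopped ht hF hBV ha hab hb]
    simp
  have hi : hBV.vectorMeasure.IntegrableOn (fun _ => c) (Ioc a b) := integrable_const _
  rw [← h1, ← VectorMeasure.integral_fun_sub (integrableOn_vectorMeasure hη hBV ha hb) hi]
  refine (VectorMeasure.norm_setIntegral_le_of_norm_le_const (C := ε)
    (μ := hBV.vectorMeasure) (B := ContinuousLinearMap.lsmul ℝ ℝ)
    (f := fun s => η s - c) hc).trans_eq ?_
  simp

theorem setIntegral_Ioc_add (hη : ContinuousOn η (Icc 0 t))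
    (hBV : BoundedVariationOn (stopped F t) univ) {a b c : ℝ}
    (ha : 0 ≤ a) (hab : a ≤ b) (hbc : b ≤ c) (hc : c ≤ t) :
    (∫ᵛ s in Ioc a c, η s ∂•hBV.vectorMeasure) = (∫ᵛ s in Ioc a b, η s ∂•hBV.vectorMeasure) +
      ∫ᵛ s in Ioc b c, η s ∂•hBV.vectorMeasure := by
  rw [← VectorMeasure.setIntegral_union (by
      rw [Set.disjoint_left]; intro x hx hx'; exact not_lt.2 hx.2 hx'.1) measurableSet_Ioc
    measurableSet_Ioc (integrableOn_vectorMeasure hη hBV ha (hbc.trans hc))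
    (integrableOn_vectorMeasure hη hBV (ha.trans hab) hc), Ioc_union_Ioc_eq_Ioc hab hbc]

theorem measureReal_Ioc_add (μ : Measure ℝ) [IsFiniteMeasure μ] {a b c : ℝ} (hab : a ≤ b)
    (hbc : b ≤ c) : μ.real (Ioc a c) = μ.real (Ioc a b) + μ.real (Ioc b c) := by
  rw [← Ioc_union_Ioc_eq_Ioc hab hbc, measureReal_union (by
      rw [Set.disjoint_left]; intro x hx hx'; exact not_lt.2 hx.2 hx'.1) measurableSet_Ioc]

/-- The Lebesgue–Stieltjes integral of a continuous function against a continuous function of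
finite variation is the limit of left Riemann sums. -/
theorem tendsto_stieltjes_sum (ht : 0 ≤ t) (hη : ContinuousOn η (Icc 0 t))
    (hF : ContinuousOn F (Icc 0 t)) (hBV : BoundedVariationOn (stopped F t) univ) :
    Tendsto (fun N => ∑ i ∈ (P.grid N).indices t, val P η N i * inc P F N i) atTop
      (𝓝 (∫ᵛ s in Ioc 0 t, η s ∂•hBV.vectorMeasure)) := by
  set μ := hBV.vectorMeasure.variation
  obtain ⟨K, hK0, hK⟩ := exists_abs_le hη
  have hbound : ∀ ε > 0, ∀ᶠ N in atTop, |∑ i ∈ (P.grid N).indices t, val P η N i * inc P F N i +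
      val P η N ((P.grid N).lastIndex t) * (F t - F ((P.grid N).pt ((P.grid N).lastIndex t))) -
      ∫ᵛ s in Ioc 0 t, η s ∂•hBV.vectorMeasure| ≤ ε * μ.real (Ioc 0 t) := by
    intro ε hε
    obtain ⟨δ, hδ, H⟩ := exists_modulus hη hε
    filter_upwards [P.eventually_step_lt hδ] with N hN
    set G := P.grid N
    have hosc : ∀ i, ∀ s, s ∈ Ioc (G.pt i) (G.pt (i + 1)) → s ≤ t → |η s - η (G.pt i)| ≤ ε := by
      intro i s hs hst
      refine (H s ⟨(G.pt_nonneg i).trans hs.1.le, hst⟩ _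
        ⟨G.pt_nonneg i, hs.1.le.trans hst⟩ ?_).le
      rw [abs_of_nonneg (by linarith [hs.1])]
      linarith [hs.2, hN i]
    -- Induction over grid points, with the error measured by the variation accumulated so far.
    have hind : ∀ k, G.pt k ≤ t → |∑ i ∈ Finset.range k, val P η N i * inc P F N i -
        ∫ᵛ s in Ioc 0 (G.pt k), η s ∂•hBV.vectorMeasure| ≤ ε * μ.real (Ioc 0 (G.pt k)) := by
      intro k
      induction k with
      | zero => intro _; simp [G.pt_zero]
      | succ k ih =>
        intro hk
        have hk' := (G.pt_le_pt_succ k).trans hk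
        have h1 := ih hk'
        have h2 := abs_setIntegral_sub_le ht hη hF hBV (G.pt_nonneg k) (G.pt_le_pt_succ k) hk
          (fun s hs => hosc k s hs (hs.2.trans hk))
        rw [Finset.sum_range_succ, setIntegral_Ioc_add hη hBV le_rfl (G.pt_nonneg k)
          (G.pt_le_pt_succ k) hk, measureReal_Ioc_add μ (G.pt_nonneg k) (G.pt_le_pt_succ k),
          mul_add]
        have h3 : val P η N k * inc P F N k =
          η (G.pt k) * (F (G.pt (k + 1)) - F (G.pt k)) := rfl
        rw [h3]
        rw [abs_le] at h1 h2 ⊢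
        constructor <;> linarith [h1.1, h1.2, h2.1, h2.2]
    have hn := G.pt_lastIndex_le ht
    have h1 := hind _ hn
    have h2 := abs_setIntegral_sub_le ht hη hF hBV (G.pt_nonneg _) hn le_rfl
      (fun s hs => hosc _ s ⟨hs.1, hs.2.trans (G.lt_pt_lastIndex_succ t).le⟩ hs.2)
    rw [setIntegral_Ioc_add hη hBV le_rfl (G.pt_nonneg _) hn le_rfl,
      measureReal_Ioc_add μ (G.pt_nonneg _) hn, mul_add, G.indices_eq_range]
    have h3 : val P η N (G.lastIndex t) = η (G.pt (G.lastIndex t)) := rfl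
    rw [h3]
    rw [abs_le] at h1 h2 ⊢
    constructor <;> linarith [h1.1, h1.2, h2.1, h2.2]
  have hstub : Tendsto (fun N => val P η N ((P.grid N).lastIndex t) *
      (F t - F ((P.grid N).pt ((P.grid N).lastIndex t)))) atTop (𝓝 0) := by
    have h := (P.tendsto_apply_lastPt ht hη).mul ((P.tendsto_apply_lastPt ht hF).const_sub (F t))
    rwa [sub_self, mul_zero] at h
  have hmain : Tendsto (fun N => ∑ i ∈ (P.grid N).indices t, val P η N i * inc P F N i +
      val P η N ((P.grid N).lastIndex t) * (F t - F ((P.grid N).pt ((P.grid N).lastIndex t))))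
      atTop (𝓝 (∫ᵛ s in Ioc 0 t, η s ∂•hBV.vectorMeasure)) := by
    rw [Metric.tendsto_nhds]
    intro ε hε
    filter_upwards [hbound (ε / (μ.real (Ioc 0 t) + 1)) (by positivity)] with N hN
    refine hN.trans_lt ?_
    rw [div_mul_eq_mul_div, div_lt_iff₀ (by positivity)]
    nlinarith [measureReal_nonneg (μ := μ) (s := Ioc 0 t)]
  have h := hmain.sub hstub
  rw [sub_zero] at h
  exact h.congr fun N => add_sub_cancel_right _ _

end Stieltjes

/-! ### The bond price: continuity and finite variation. -/

section Bond

variable {r : ℝ → ℝ} {t : ℝ}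

/-- The logarithm `∫₀ᵗ r_s ds` of the bond price. -/
def logBond (r : ℝ → ℝ) (t : ℝ) : ℝ := ∫ s in (0 : ℝ)..t, r s

theorem bond_eq_exp (r : ℝ → ℝ) (t : ℝ) : bond r t = Real.exp (logBond r t) := rfl

theorem bond_pos (r : ℝ → ℝ) (t : ℝ) : 0 < bond r t := Real.exp_pos _

theorem logBond_zero (r : ℝ → ℝ) : logBond r 0 = 0 := intervalIntegral.integral_same

theorem bond_zero (r : ℝ → ℝ) : bond r 0 = 1 := by rw [bond_eq_exp, logBond_zero, Real.exp_zero]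

theorem intervalIntegrable_rate (hr : ∀ t : ℝ, 0 < t → IntegrableOn r (Icc 0 t)) {u v : ℝ}
    (hu : 0 ≤ u) (huv : u ≤ v) : IntervalIntegrable r volume u v := by
  rw [intervalIntegrable_iff_integrableOn_Ioc_of_le huv]
  exact (hr (v + 1) (by linarith)).mono_set fun s hs => ⟨hu.trans hs.1.le, by linarith [hs.2]⟩

theorem abs_logBond_sub_le (hr : ∀ t : ℝ, 0 < t → IntegrableOn r (Icc 0 t)) {u v : ℝ}
    (hu : 0 ≤ u) (huv : u ≤ v) : |logBond r v - logBond r u| ≤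
      (∫ s in (0 : ℝ)..v, |r s|) - ∫ s in (0 : ℝ)..u, |r s| := by
  rw [logBond, logBond, intervalIntegral.integral_interval_sub_left
    (intervalIntegrable_rate hr le_rfl (hu.trans huv)) (intervalIntegrable_rate hr le_rfl hu),
    intervalIntegral.integral_interval_sub_left
    (intervalIntegrable_rate hr le_rfl (hu.trans huv)).abs
    (intervalIntegrable_rate hr le_rfl hu).abs]
  exact intervalIntegral.abs_integral_le_integral_abs huv

theorem continuousOn_logBond (hr : ∀ t : ℝ, 0 < t → IntegrableOn r (Icc 0 t)) :
    ContinuousOn (logBond r) (Ici 0) := by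
  intro x hx
  have hx1 : (0 : ℝ) < x + 1 := by linarith [mem_Ici.1 hx]
  have h := intervalIntegral.continuousOn_primitive_interval (μ := volume) (f := r) (a := 0)
    (b := x + 1) (by rw [uIcc_of_le hx1.le]; exact hr _ hx1)
  rw [uIcc_of_le hx1.le] at h
  refine (h x ⟨hx, by linarith⟩).mono_of_mem_nhdsWithin ?_
  rw [← Ici_inter_Iic]
  exact inter_mem_nhdsWithin _ (Iic_mem_nhds (lt_add_one x))

theorem continuousOn_bond (hr : ∀ t : ℝ, 0 < t → IntegrableOn r (Icc 0 t)) :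
    ContinuousOn (bond r) (Ici 0) := (continuousOn_logBond hr).rexp

/-- On `[-K, K]` the exponential is Lipschitz with constant `exp K`, so the variation of `∫ r`
carries over to the bond. -/
theorem exists_abs_bond_sub_le (hr : ∀ t : ℝ, 0 < t → IntegrableOn r (Icc 0 t)) (t : ℝ) :
    ∃ V : ℝ → ℝ, ∀ u ∈ Icc 0 t, ∀ v ∈ Icc 0 t, u ≤ v → |bond r v - bond r u| ≤ V v - V u := by
  obtain ⟨K, hK0, hK⟩ := exists_abs_le ((continuousOn_logBond hr).mono
    (fun s (hs : s ∈ Icc 0 t) => hs.1))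
  refine ⟨fun s => Real.exp K * ∫ x in (0 : ℝ)..s, |r x|, fun u hu v hv huv => ?_⟩
  rw [← mul_sub]
  refine le_trans ?_ (mul_le_mul_of_nonneg_left (abs_logBond_sub_le hr hu.1 huv)
    (Real.exp_pos K).le)
  have h := Convex.norm_image_sub_le_of_norm_hasDerivWithin_le (f := Real.exp) (f' := Real.exp)
    (s := Icc (-K) K) (C := Real.exp K) (x := logBond r u) (y := logBond r v)
    (fun x _ => (Real.hasDerivAt_exp x).hasDerivWithinAt)
    (fun x hx => by rw [Real.norm_eq_abs, Real.abs_exp]; exact Real.exp_le_exp.2 hx.2)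
    (convex_Icc _ _) (abs_le.1 (hK u hu)) (abs_le.1 (hK v hv))
  exact h

theorem boundedVariationOn_stopped_bond (hr : ∀ t : ℝ, 0 < t → IntegrableOn r (Icc 0 t))
    (ht : 0 ≤ t) : BoundedVariationOn (stopped (bond r) t) univ := by
  obtain ⟨V, hV⟩ := exists_abs_bond_sub_le hr t
  exact boundedVariationOn_stopped ht (boundedVariationOn_of_abs_sub_le ht hV)

/-- Brings the bond term of the self-financing condition to the same grid sums as the Itô term. -/
theorem HasStieltjesIntegral.tendsto {P : RefiningGrids} {η : ℝ → ℝ} {J : ℝ}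
    (h : HasStieltjesIntegral η (bond r) t J)
    (hr : ∀ t : ℝ, 0 < t → IntegrableOn r (Icc 0 t)) (ht : 0 ≤ t)
    (hη : ContinuousOn η (Icc 0 t)) :
    Tendsto (fun N => ∑ i ∈ (P.grid N).indices t, val P η N i * inc P (bond r) N i) atTop
      (𝓝 J) := by
  obtain ⟨hF, _, rfl⟩ := h
  exact tendsto_stieltjes_sum ht hη ((continuousOn_bond hr).mono Icc_subset_Ici_self) hF

theorem exists_hasStieltjesIntegral {η : ℝ → ℝ}
    (hr : ∀ t : ℝ, 0 < t → IntegrableOn r (Icc 0 t)) (ht : 0 ≤ t)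
    (hη : ContinuousOn η (Icc 0 t)) : ∃ J, HasStieltjesIntegral η (bond r) t J :=
  ⟨_, boundedVariationOn_stopped_bond hr ht, integrableOn_vectorMeasure hη _ le_rfl le_rfl, rfl⟩

end Bond

/-- A continuous positive path with continuous quadratic variation along the grids. -/
structure IsPricePath (P : RefiningGrids) (S : ℝ → ℝ) : Prop where
  continuousOn : ContinuousOn S (Ici 0)
  pos : ∀ t, 0 ≤ t → 0 < S t
  quadVar : HasContinuousQuadVar P S

/-- A rate function that is integrable on compact intervals. -/
def IsShortRate (r : ℝ → ℝ) : Prop := ∀ t : ℝ, 0 < t → IntegrableOn r (Icc 0 t)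

/-- The logarithm of the price. -/
def logPrice (S : ℝ → ℝ) (t : ℝ) : ℝ := Real.log (S t)

/-- The finite variation part of the logarithm of the normalised cushion. -/
def cushionDrift (P : RefiningGrids) (r S : ℝ → ℝ) (m t : ℝ) : ℝ :=
  (1 - m) * logBond r t - 1 / 2 * m * (m - 1) * quadVar P (logPrice S) t - m * logPrice S 0

/-- The logarithm of the normalised cushion. -/
def logCushion (P : RefiningGrids) (r S : ℝ → ℝ) (m t : ℝ) : ℝ :=
  m * logPrice S t + cushionDrift P r S m t

/-! ### Second-order expansions of stock, bond and cushion returns. -/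

section Expansions

variable {P : RefiningGrids} {r S F : ℝ → ℝ} {m t : ℝ}

theorem IsPricePath.continuousOn_log (hS : IsPricePath P S) : ContinuousOn (logPrice S) (Ici 0) :=
  continuousOn_log_comp hS.continuousOn hS.pos

theorem IsPricePath.quadVar_log (hS : IsPricePath P S) : HasContinuousQuadVar P (logPrice S) :=
  hasContinuousQuadVar_log hS.continuousOn hS.pos hS.quadVar

theorem continuousOn_cushionDrift (hS : IsPricePath P S) (hr : IsShortRate r) (m : ℝ) :
    ContinuousOn (cushionDrift P r S m) (Ici 0) :=
  (((continuousOn_logBond hr).const_mul _).sub (hS.quadVar_log.2.const_mul _)).sub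
    continuousOn_const

theorem continuousOn_logCushion (hS : IsPricePath P S) (hr : IsShortRate r) (m : ℝ) :
    ContinuousOn (logCushion P r S m) (Ici 0) :=
  (hS.continuousOn_log.const_mul m).add (continuousOn_cushionDrift hS hr m)

theorem exists_abs_cushionDrift_sub_le (hS : IsPricePath P S) (hr : IsShortRate r) (m t : ℝ) :
    ∃ V : ℝ → ℝ, ∀ u ∈ Icc 0 t, ∀ v ∈ Icc 0 t, u ≤ v →
      |cushionDrift P r S m v - cushionDrift P r S m u| ≤ V v - V u := by
  refine ⟨fun s => |1 - m| * (∫ x in (0 : ℝ)..s, |r x|) +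
    |1 / 2 * m * (m - 1)| * quadVar P (logPrice S) s, fun u hu v hv huv => ?_⟩
  have h1 := mul_le_mul_of_nonneg_left (abs_logBond_sub_le hr hu.1 huv) (abs_nonneg (1 - m))
  have h2 := sub_nonneg.2 (hS.quadVar_log.mono hu.1 huv)
  have h3 : cushionDrift P r S m v - cushionDrift P r S m u =
      (1 - m) * (logBond r v - logBond r u) + -(1 / 2 * m * (m - 1) *
        (quadVar P (logPrice S) v - quadVar P (logPrice S) u)) := by
    simp only [cushionDrift]; ring
  rw [h3]
  refine (abs_add_le _ _).trans ?_
  rw [abs_neg, abs_mul, abs_mul _ (quadVar P (logPrice S) v - _), abs_of_nonneg h2]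
  linarith

theorem sumBounded_inc_cushionDrift (hS : IsPricePath P S) (hr : IsShortRate r) (m : ℝ)
    (ht : 0 ≤ t) : SumBounded P t (inc P (cushionDrift P r S m)) := by
  obtain ⟨V, hV⟩ := exists_abs_cushionDrift_sub_le hS hr m t
  exact sumBounded_inc ht hV

theorem sumBounded_inc_logBond (hr : IsShortRate r) (ht : 0 ≤ t) :
    SumBounded P t (inc P (logBond r)) :=
  sumBounded_inc (V := fun s => ∫ x in (0 : ℝ)..s, |r x|) ht
    fun _ hu _ _ huv => abs_logBond_sub_le hr hu.1 huv

/-- Second order expansion of the exponential of a path with quadratic variation, up to an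
array whose absolute sum is negligible. -/
theorem negligible_exp_expansion {X : ℝ → ℝ} (hX : ContinuousOn X (Icc 0 t))
    (hq : HasContinuousQuadVar P X) (hF : ContinuousOn F (Icc 0 t))
    (hF' : SumBounded P t (inc P F)) (ht : 0 ≤ t) (a b : ℝ) :
    Negligible P t fun N i => Real.exp (a * inc P X N i + b * inc P F N i) - 1 -
      (a * inc P X N i + b * inc P F N i) - a ^ 2 / 2 * inc P X N i ^ 2 := by
  have hsX := (unifSmall_inc (P := P) hX).const_mul a
  have hsF := (unifSmall_inc (P := P) hF).const_mul b
  have hbF := hF'.const_mul b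
  -- The factorisation of `(a ΔX + b ΔF)² - a² (ΔX)²`. Boundedness suffices for the square sums;
  -- smallness of the first factor, used below in `h2`, makes half of this term negligible.
  have hcross : SumBounded P t fun N i =>
      (2 * (a * inc P X N i) + b * inc P F N i) * (b * inc P F N i) := by
    obtain ⟨K, hK⟩ := unifBounded_inc (P := P) hX
    obtain ⟨L, hL⟩ := unifBounded_inc (P := P) hF
    refine UnifBounded.mul_sumBounded ⟨2 * (|a| * K) + |b| * L, fun N i hi => ?_⟩ hbF
    refine (abs_add_le _ _).trans ?_
    rw [abs_mul, abs_mul, abs_mul, abs_two]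
    have := mul_le_mul_of_nonneg_left (hK N i hi) (abs_nonneg a)
    have := mul_le_mul_of_nonneg_left (hL N i hi) (abs_nonneg b)
    linarith
  have hsq : SumBounded P t fun N i => (a * inc P X N i + b * inc P F N i) ^ 2 :=
    (((hq.sumBounded ht).const_mul (a ^ 2)).add hcross).mono fun N i _ => by
      apply le_of_eq; congr 1; ring
  have h1 := negligible_exp_quadratic (hsX.add hsF) hsq
  have h2 := (((hsX.const_mul 2).add hsF).mul_sumBounded hbF).const_mul (1 / 2)
  exact (h1.add h2).congr fun N i _ => by ring

theorem inc_exp (P : RefiningGrids) (Y : ℝ → ℝ) (N i : ℕ) :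
    inc P (fun s => Real.exp (Y s)) N i =
      Real.exp (Y ((P.grid N).pt i)) * (Real.exp (inc P Y N i) - 1) := by
  simp only [inc]
  rw [mul_sub, mul_one, ← Real.exp_add, add_sub_cancel]

theorem IsPricePath.inc_eq (hS : IsPricePath P S) (N i : ℕ) :
    inc P S N i = S ((P.grid N).pt i) * (Real.exp (inc P (logPrice S) N i) - 1) := by
  have h : ∀ j, S ((P.grid N).pt j) = Real.exp (logPrice S ((P.grid N).pt j)) := fun j =>
    (Real.exp_log (hS.pos _ ((P.grid N).pt_nonneg j))).symm
  have h1 := inc_exp P (logPrice S) N i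
  simp only [inc] at h1 ⊢
  rw [← h, ← h] at h1
  exact h1

theorem inc_bond (P : RefiningGrids) (r : ℝ → ℝ) (N i : ℕ) : inc P (bond r) N i =
    bond r ((P.grid N).pt i) * (Real.exp (inc P (logBond r) N i) - 1) :=
  inc_exp P (logBond r) N i

theorem inc_logCushion (P : RefiningGrids) (r S : ℝ → ℝ) (m : ℝ) (N i : ℕ) :
    inc P (logCushion P r S m) N i =
      m * inc P (logPrice S) N i + inc P (cushionDrift P r S m) N i := by
  simp only [inc, logCushion]; ring

theorem inc_cushionDrift (P : RefiningGrids) (r S : ℝ → ℝ) (m : ℝ) (N i : ℕ) :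
    inc P (cushionDrift P r S m) N i = (1 - m) * inc P (logBond r) N i -
      1 / 2 * m * (m - 1) * inc P (quadVar P (logPrice S)) N i := by
  simp only [inc, cushionDrift]; ring

theorem IsPricePath.negligible_return (hS : IsPricePath P S) (ht : 0 ≤ t) :
    Negligible P t fun N i => Real.exp (inc P (logPrice S) N i) - 1 - inc P (logPrice S) N i -
      inc P (logPrice S) N i ^ 2 / 2 := by
  have h := negligible_exp_expansion (hS.continuousOn_log.mono Icc_subset_Ici_self)
    hS.quadVar_log (F := fun _ => 0) continuousOn_const ⟨0, fun N => by simp [inc]⟩ ht 1 0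
  exact h.congr fun N i _ => by rw [one_mul, zero_mul, add_zero]; ring

theorem negligible_bond_return (hr : IsShortRate r) (ht : 0 ≤ t) :
    Negligible P t fun N i => Real.exp (inc P (logBond r) N i) - 1 - inc P (logBond r) N i :=
  negligible_exp_linear (unifSmall_inc ((continuousOn_logBond hr).mono Icc_subset_Ici_self))
    (sumBounded_inc_logBond hr ht)

theorem negligible_cushion_return (hS : IsPricePath P S) (hr : IsShortRate r) (ht : 0 ≤ t)
    (m : ℝ) : Negligible P t fun N i => Real.exp (inc P (logCushion P r S m) N i) - 1 -
      inc P (logCushion P r S m) N i - m ^ 2 / 2 * inc P (logPrice S) N i ^ 2 := by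
  have h := negligible_exp_expansion (hS.continuousOn_log.mono Icc_subset_Ici_self)
    hS.quadVar_log ((continuousOn_cushionDrift hS hr m).mono Icc_subset_Ici_self)
    (sumBounded_inc_cushionDrift hS hr m ht) ht m 1
  exact h.congr fun N i _ => by rw [one_mul, inc_logCushion]

theorem negligible_inv_cushion_return (hS : IsPricePath P S) (hr : IsShortRate r) (ht : 0 ≤ t)
    (m : ℝ) : Negligible P t fun N i => Real.exp (-inc P (logCushion P r S m) N i) - 1 +
      inc P (logCushion P r S m) N i - m ^ 2 / 2 * inc P (logPrice S) N i ^ 2 := by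
  have h := negligible_exp_expansion (hS.continuousOn_log.mono Icc_subset_Ici_self)
    hS.quadVar_log ((continuousOn_cushionDrift hS hr m).mono Icc_subset_Ici_self)
    (sumBounded_inc_cushionDrift hS hr m ht) ht (-m) (-1)
  exact h.congr fun N i _ => by
    rw [inc_logCushion, show -m * inc P (logPrice S) N i + -1 * inc P (cushionDrift P r S m) N i =
      -(m * inc P (logPrice S) N i + inc P (cushionDrift P r S m) N i) by ring]
    ring

theorem logCushion_zero (P : RefiningGrids) (r S : ℝ → ℝ) (m : ℝ) : logCushion P r S m 0 = 0 := by
  simp [logCushion, cushionDrift, logBond_zero, quadVar_zero]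

/-- In exponential form the return of the cushion depends only on the increment of `logCushion`. -/
theorem cppiCushion_eq (hS : IsPricePath P S) (r : ℝ → ℝ) (V₀ α m : ℝ) (ht : 0 ≤ t) :
    cppiCushion P r S V₀ α m t = (1 - α) * V₀ * Real.exp (logCushion P r S m t) := by
  have h0 := hS.pos 0 le_rfl
  have h1 := hS.pos t ht
  rw [cppiCushion, Real.rpow_def_of_pos (div_pos h1 h0), bond_eq_exp, ← Real.exp_mul,
    mul_assoc, mul_assoc, ← Real.exp_add, ← Real.exp_add, Real.log_div h1.ne' h0.ne']
  congr 2
  rw [logCushion, cushionDrift, show logPrice S = fun s => Real.log (S s) from rfl]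
  ring

theorem cppiCushion_zero (hS : IsPricePath P S) (r : ℝ → ℝ) (V₀ α m : ℝ) :
    cppiCushion P r S V₀ α m 0 = (1 - α) * V₀ := by
  rw [cppiCushion_eq hS r V₀ α m le_rfl, logCushion_zero, Real.exp_zero, mul_one]

theorem continuousOn_cppiCushion (hS : IsPricePath P S) (hr : IsShortRate r) (V₀ α m : ℝ) :
    ContinuousOn (cppiCushion P r S V₀ α m) (Ici 0) :=
  ((continuousOn_logCushion hS hr m).rexp.const_mul ((1 - α) * V₀)).congr
    fun _ hs => cppiCushion_eq hS r V₀ α m hs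

theorem continuousOn_cppiValue (hS : IsPricePath P S) (hr : IsShortRate r) (V₀ α m : ℝ) :
    ContinuousOn (cppiValue P r S V₀ α m) (Ici 0) :=
  (continuousOn_cppiCushion hS hr V₀ α m).add ((continuousOn_bond hr).const_mul _)

theorem continuousOn_cppiStock (hS : IsPricePath P S) (hr : IsShortRate r) (V₀ α m : ℝ) :
    ContinuousOn (cppiStock P r S V₀ α m) (Ici 0) :=
  ((continuousOn_cppiCushion hS hr V₀ α m).const_mul m).div hS.continuousOn
    fun s hs => (hS.pos s hs).ne'

theorem continuousOn_cppiBond (hS : IsPricePath P S) (hr : IsShortRate r) (V₀ α m : ℝ) :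
    ContinuousOn (cppiBond P r S V₀ α m) (Ici 0) :=
  ((continuousOn_cppiValue hS hr V₀ α m).sub
    ((continuousOn_cppiCushion hS hr V₀ α m).const_mul m)).div (continuousOn_bond hr)
    fun s _ => (bond_pos r s).ne'

theorem portfolioValue_cppi (hS : IsPricePath P S) (r : ℝ → ℝ) (V₀ α m : ℝ) (ht : 0 ≤ t) :
    portfolioValue r S (cppiStock P r S V₀ α m) (cppiBond P r S V₀ α m) t =
      cppiValue P r S V₀ α m t := by
  have h1 := (hS.pos t ht).ne'
  have h2 := (bond_pos r t).ne'
  rw [portfolioValue, cppiStock, cppiBond]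
  field_simp
  ring

end Expansions

/-! ### The explicit strategy is self-financing. -/

section Existence

variable {P : RefiningGrids} {r S : ℝ → ℝ} {t : ℝ}

/-- The floor terms `α V₀ ΔB` cancel. The first-order terms leave `½ m (m - 1) q`, the second-order
ones `(m / 2 - m² / 2) l²`; together they form the compensated square. -/
theorem inc_cppi_eq (hS : IsPricePath P S) (r : ℝ → ℝ) (V₀ α m : ℝ) (N i : ℕ) :
    val P (cppiStock P r S V₀ α m) N i * inc P S N i +
      val P (cppiBond P r S V₀ α m) N i * inc P (bond r) N i -
      inc P (cppiValue P r S V₀ α m) N i =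
    val P (cppiCushion P r S V₀ α m) N i *
      ((m * (Real.exp (inc P (logPrice S) N i) - 1 - inc P (logPrice S) N i -
        inc P (logPrice S) N i ^ 2 / 2) +
      (1 - m) * (Real.exp (inc P (logBond r) N i) - 1 - inc P (logBond r) N i)) -
      (Real.exp (inc P (logCushion P r S m) N i) - 1 -
        inc P (logCushion P r S m) N i - m ^ 2 / 2 * inc P (logPrice S) N i ^ 2)) +
    -(1 / 2) * m * (m - 1) * (val P (cppiCushion P r S V₀ α m) N i *
      (inc P (logPrice S) N i ^ 2 - inc P (quadVar P (logPrice S)) N i)) := by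
  have hp := (P.grid N).pt_nonneg
  have h1 := (hS.pos _ (hp i)).ne'
  have h2 := (bond_pos r ((P.grid N).pt i)).ne'
  have hV : inc P (cppiValue P r S V₀ α m) N i = val P (cppiCushion P r S V₀ α m) N i *
      (Real.exp (inc P (logCushion P r S m) N i) - 1) + α * V₀ * inc P (bond r) N i := by
    have h3 := inc_exp P (logCushion P r S m) N i
    simp only [inc, val, cppiValue, cppiCushion_eq hS r V₀ α m (hp _)] at h3 ⊢
    linear_combination (1 - α) * V₀ * h3
  rw [hV, inc_logCushion, inc_cushionDrift, hS.inc_eq, inc_bond]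
  simp only [val, cppiStock, cppiBond, cppiValue]
  field_simp
  ring

theorem tendsto_sum_cppi (hS : IsPricePath P S) (hr : IsShortRate r) (V₀ α m : ℝ) (ht : 0 ≤ t) :
    Tendsto (fun N => ∑ i ∈ (P.grid N).indices t,
      (val P (cppiStock P r S V₀ α m) N i * inc P S N i +
      val P (cppiBond P r S V₀ α m) N i * inc P (bond r) N i -
      inc P (cppiValue P r S V₀ α m) N i)) atTop (𝓝 0) := by
  have hC : ContinuousOn (cppiCushion P r S V₀ α m) (Icc 0 t) :=
    (continuousOn_cppiCushion hS hr V₀ α m).mono Icc_subset_Ici_self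
  have h1 := ((unifBounded_val (P := P) hC).mul_negligible
    ((((hS.negligible_return ht).const_mul m).add
      ((negligible_bond_return (P := P) hr ht).const_mul (1 - m))).sub
      (negligible_cushion_return hS hr ht m))).tendsto_sum
  have h2 := (hS.quadVar_log.tendsto_sum_val_mul ht hC).const_mul (-(1 / 2) * m * (m - 1))
  have h3 := h1.add h2
  rw [mul_zero, add_zero] at h3
  refine h3.congr fun N => ?_
  rw [Finset.mul_sum, ← Finset.sum_add_distrib]
  exact Finset.sum_congr rfl fun i _ => (inc_cppi_eq hS r V₀ α m N i).symm

/-- A smooth positive function on the line which is the identity on `[δ, ∞)`. -/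
theorem exists_contDiff_pos_eq_id {δ : ℝ} (hδ : 0 < δ) :
    ∃ τ : ℝ → ℝ, ContDiff ℝ 1 τ ∧ (∀ x, 0 < τ x) ∧ ∀ x, δ ≤ x → τ x = x := by
  refine ⟨fun x => δ / 2 + Real.smoothTransition ((x - δ / 2) / (δ / 2)) * (x - δ / 2),
    ?_, fun x => ?_, fun x hx => ?_⟩
  · have h : ContDiff ℝ 1 fun x : ℝ => (x - δ / 2) / (δ / 2) :=
      (contDiff_id.sub contDiff_const).div_const _
    exact contDiff_const.add ((Real.smoothTransition.contDiff.comp h).mul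
      (contDiff_id.sub contDiff_const))
  · show 0 < δ / 2 + Real.smoothTransition ((x - δ / 2) / (δ / 2)) * (x - δ / 2)
    rcases le_total x (δ / 2) with h | h
    · rw [Real.smoothTransition.zero_of_nonpos
        (div_nonpos_of_nonpos_of_nonneg (by linarith) (by linarith))]
      linarith
    · have := mul_nonneg (Real.smoothTransition.nonneg ((x - δ / 2) / (δ / 2))) (sub_nonneg.2 h)
      linarith
  · show δ / 2 + Real.smoothTransition ((x - δ / 2) / (δ / 2)) * (x - δ / 2) = x
    rw [Real.smoothTransition.one_of_one_le ((one_le_div (by linarith)).2 (by linarith))]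
    ring

/-- The natural `g` involves `log x` and `1 / x`, which are not `C¹` on the line. As `S` has a
positive minimum on `[0, T]`, `x` can be replaced by a positive `C¹` function `τ` agreeing with it
on the range of `S`. The only finite variation component is `cushionDrift`. -/
theorem isAdmissibleIntegrand_cppiStock (hS : IsPricePath P S) (hr : IsShortRate r)
    (V₀ α m : ℝ) : IsAdmissibleIntegrand S (cppiStock P r S V₀ α m) := by
  intro T hT
  obtain ⟨x, hx, hmin⟩ := isCompact_Icc.exists_isMinOn (nonempty_Icc.2 hT.le)
    (hS.continuousOn.mono (Icc_subset_Ici_self : Icc 0 T ⊆ Ici 0))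
  obtain ⟨τ, hτ, hτ_pos, hτ_eq⟩ := exists_contDiff_pos_eq_id (hS.pos x hx.1)
  refine ⟨1, fun p => m * ((1 - α) * V₀ * Real.exp (m * Real.log (τ p.2) + p.1 0)) / τ p.2,
    fun s _ => cushionDrift P r S m s, ?_, ?_, ?_, ?_⟩
  · have h2 : ContDiff ℝ 1 fun p : (Fin 1 → ℝ) × ℝ => τ p.2 := hτ.comp contDiff_snd
    have h1 : ContDiff ℝ 1 fun p : (Fin 1 → ℝ) × ℝ => p.1 0 := by fun_prop
    exact (contDiff_const.mul (contDiff_const.mul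
      ((contDiff_const.mul (h2.log fun p => (hτ_pos _).ne')).add h1).exp)).div h2
      fun p => (hτ_pos _).ne'
  · exact continuousOn_pi.2 fun _ => continuousOn_cushionDrift hS hr m
  · obtain ⟨V, hV⟩ := exists_abs_cushionDrift_sub_le hS hr m T
    exact fun _ => boundedVariationOn_of_abs_sub_le hT.le hV
  · intro s hs
    have h : τ (S s) = S s := hτ_eq _ (hmin hs)
    rw [cppiStock, cppiCushion_eq hS r V₀ α m hs.1]
    simp only [h]
    rfl

theorem isSelfFinancing_cppi (hS : IsPricePath P S) (hr : IsShortRate r) (V₀ α m : ℝ) :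
    IsSelfFinancing P r S (cppiStock P r S V₀ α m) (cppiBond P r S V₀ α m) where
  measurable_stock :=
    (continuousOn_iff_continuous_domRestrict.1 (continuousOn_cppiStock hS hr V₀ α m)).measurable
  measurable_bond :=
    (continuousOn_iff_continuous_domRestrict.1 (continuousOn_cppiBond hS hr V₀ α m)).measurable
  admissible := isAdmissibleIntegrand_cppiStock hS hr V₀ α m
  integrable t ht := by
    have h : IntegrableOn r (Icc 0 t) :=
      (hr (t + 1) (by linarith)).mono_set (Icc_subset_Icc_right (by linarith))
    exact h.continuousOn_mul ((continuousOn_cppiBond hS hr V₀ α m).mono Icc_subset_Ici_self)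
      isCompact_Icc
  value_eq t ht := by
    have hη : ContinuousOn (cppiBond P r S V₀ α m) (Icc 0 t) :=
      (continuousOn_cppiBond hS hr V₀ α m).mono Icc_subset_Ici_self
    obtain ⟨J, hJ⟩ := exists_hasStieltjesIntegral hr ht hη
    -- The Itô integral is given the value dictated by the self-financing equation; convergence of
    -- its sums follows from that of the other two sums.
    refine ⟨cppiValue P r S V₀ α m t - cppiValue P r S V₀ α m 0 - J, J, ?_, hJ, ?_⟩
    · have hV : ContinuousOn (cppiValue P r S V₀ α m) (Icc 0 t) :=
        (continuousOn_cppiValue hS hr V₀ α m).mono Icc_subset_Ici_self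
      have h := ((tendsto_sum_cppi hS hr V₀ α m ht).add (tendsto_sum_inc (P := P) ht hV)).sub
        (hJ.tendsto (P := P) hr ht hη)
      rw [zero_add] at h
      refine h.congr fun N => ?_
      rw [← Finset.sum_add_distrib, ← Finset.sum_sub_distrib]
      refine Finset.sum_congr rfl fun i _ => ?_
      simp only [val, inc]
      ring
    · rw [portfolioValue_cppi hS r V₀ α m ht, portfolioValue_cppi hS r V₀ α m le_rfl]
      ring

theorem followsCPPI_cppi (hS : IsPricePath P S) (r : ℝ → ℝ) (V₀ α m : ℝ) :
    FollowsCPPI r S V₀ α m (cppiStock P r S V₀ α m) (cppiBond P r S V₀ α m) where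
  initial := by
    rw [portfolioValue_cppi hS r V₀ α m le_rfl, cppiValue, cppiCushion_zero hS, bond_zero]
    ring
  stock_eq t ht := by
    rw [portfolioValue_cppi hS r V₀ α m ht, cppiValue, add_sub_cancel_right, cppiStock]
  bond_eq t ht := by
    rw [portfolioValue_cppi hS r V₀ α m ht, cppiStock, cppiBond,
      div_mul_cancel₀ _ (hS.pos t ht).ne']
  bond_eq' t ht := by
    rw [portfolioValue_cppi hS r V₀ α m ht, cppiBond]
    congr 3
    rw [cppiValue, add_sub_cancel_right]

theorem le_cppiValue (hS : IsPricePath P S) (r : ℝ → ℝ) {V₀ α : ℝ} (m : ℝ) (hV₀ : 0 ≤ V₀)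
    (hα : α ≤ 1) (ht : 0 ≤ t) : α * V₀ * bond r t ≤ cppiValue P r S V₀ α m t := by
  rw [cppiValue, cppiCushion_eq hS r V₀ α m ht]
  have : 0 ≤ (1 - α) * V₀ * Real.exp (logCushion P r S m t) :=
    mul_nonneg (mul_nonneg (sub_nonneg.2 hα) hV₀) (Real.exp_pos _).le
  linarith

end Existence

/-! ### Deterministic estimates for Riemann sums of `g(A, s)` against `s`. -/

section Taylor

variable {n : ℕ} {g : (Fin n → ℝ) × ℝ → ℝ}

/-- The partial derivative of `g` in the last variable. -/
def derivLast (g : (Fin n → ℝ) × ℝ → ℝ) (q : (Fin n → ℝ) × ℝ) : ℝ := fderiv ℝ g q (0, 1)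

theorem continuous_derivLast (hg : ContDiff ℝ 1 g) : Continuous (derivLast g) :=
  (hg.continuous_fderiv one_ne_zero).clm_apply continuous_const

theorem hasDerivAt_last (hg : ContDiff ℝ 1 g) (a : Fin n → ℝ) (x : ℝ) :
    HasDerivAt (fun z => g (a, z)) (derivLast g (a, x)) x := by
  have h1 : HasFDerivAt g (fderiv ℝ g (a, x)) (a, x) :=
    (hg.differentiable one_ne_zero (a, x)).hasFDerivAt
  exact h1.comp_hasDerivAt x ((hasDerivAt_const x a).prodMk (hasDerivAt_id x))

theorem exists_lipschitz_first (hg : ContDiff ℝ 1 g) (R : ℝ) :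
    ∃ L, 0 ≤ L ∧ ∀ a b : Fin n → ℝ, ∀ x : ℝ, ‖a‖ ≤ R → ‖b‖ ≤ R → |x| ≤ R →
      |g (a, x) - g (b, x)| ≤ L * ‖a - b‖ := by
  obtain ⟨K, hK⟩ := (hg.contDiffOn (s := Metric.closedBall 0 R)).exists_lipschitzOnWith one_ne_zero
    (convex_closedBall _ _) (isCompact_closedBall _ _)
  refine ⟨K, K.2, fun a b x ha hb hx => ?_⟩
  have h := hK.dist_le_mul (a, x) (by simp [Prod.norm_def, ha, hx])
    (b, x) (by simp [Prod.norm_def, hb, hx])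
  simpa [Prod.dist_eq, dist_eq_norm, Real.norm_eq_abs] using h

/-- Uniform continuity of the last partial derivative on a ball linearises `g (a, ·)` uniformly;
integrating gives the second-order expansion of its antiderivative. No second derivative of `g` is
needed. -/
theorem exists_taylor_modulus (hg : ContDiff ℝ 1 g) (R : ℝ) {ε : ℝ} (hε : 0 < ε) :
    ∃ δ > 0, ∀ a : Fin n → ℝ, ∀ x y : ℝ, ‖a‖ ≤ R → |x| ≤ R → |y| ≤ R → |y - x| < δ →
      |(∫ z in x..y, g (a, z)) - g (a, x) * (y - x) -
        derivLast g (a, x) / 2 * (y - x) ^ 2| ≤ ε * (y - x) ^ 2 := by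
  have huc := (isCompact_closedBall (0 : (Fin n → ℝ) × ℝ) R).uniformContinuousOn_of_continuous
    (continuous_derivLast hg).continuousOn
  obtain ⟨δ, hδ, H⟩ := Metric.uniformContinuousOn_iff.1 huc ε hε
  refine ⟨δ, hδ, fun a x y ha hx hy hxy => ?_⟩
  have hcont : Continuous fun z => g (a, z) := hg.continuous.comp (by fun_prop)
  have hmem : ∀ z ∈ uIcc x y, |z| ≤ R := fun z hz =>
    abs_le.2 (uIcc_subset_Icc (abs_le.1 hx) (abs_le.1 hy) hz)
  have hderiv : ∀ z ∈ uIcc x y, ‖derivLast g (a, z) - derivLast g (a, x)‖ ≤ ε := by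
    intro z hz
    refine (H (a, z) ?_ (a, x) ?_ ?_).le
    · simp [Prod.norm_def, ha, hmem z hz]
    · simp [Prod.norm_def, ha, hx]
    · rw [Prod.dist_eq, dist_self, Real.dist_eq, max_eq_right (abs_nonneg _)]
      exact (abs_sub_left_of_mem_uIcc hz).trans_lt hxy
  have hlin : ∀ z ∈ uIcc x y,
      |g (a, z) - g (a, x) - derivLast g (a, x) * (z - x)| ≤ ε * |y - x| := by
    intro z hz
    have h := Convex.norm_image_sub_le_of_norm_hasDerivWithin_le
      (f := fun z => g (a, z) - derivLast g (a, x) * z) (s := uIcc x y) (C := ε) (x := x) (y := z)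
      (fun w _ => ((hasDerivAt_last hg a w).sub
        ((hasDerivAt_id w).const_mul (derivLast g (a, x)))).hasDerivWithinAt)
      (fun w hw => by simpa using hderiv w hw) (convex_uIcc _ _) left_mem_uIcc hz
    rw [Real.norm_eq_abs, Real.norm_eq_abs] at h
    have h2 : g (a, z) - derivLast g (a, x) * z - (g (a, x) - derivLast g (a, x) * x) =
      g (a, z) - g (a, x) - derivLast g (a, x) * (z - x) := by ring
    rw [h2] at h
    exact h.trans (mul_le_mul_of_nonneg_left (abs_sub_left_of_mem_uIcc hz) hε.le)
  have h := intervalIntegral.norm_integral_le_of_norm_le_const (a := x) (b := y)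
    (f := fun z => g (a, z) - g (a, x) - derivLast g (a, x) * (z - x)) (C := ε * |y - x|)
    fun z hz => hlin z (uIoc_subset_uIcc hz)
  have hint : (∫ z in x..y, (g (a, z) - g (a, x) - derivLast g (a, x) * (z - x))) =
      (∫ z in x..y, g (a, z)) - g (a, x) * (y - x) - derivLast g (a, x) / 2 * (y - x) ^ 2 := by
    rw [intervalIntegral.integral_sub, intervalIntegral.integral_sub,
      intervalIntegral.integral_const, intervalIntegral.integral_const_mul,
      intervalIntegral.integral_sub, integral_id, intervalIntegral.integral_const]
    · simp only [smul_eq_mul]; ring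
    all_goals exact Continuous.intervalIntegrable (by fun_prop) _ _
  rw [hint, Real.norm_eq_abs, mul_assoc, ← sq, sq_abs] at h
  exact h

/-- Telescope `∫ z in s b..s j, g (A j, z)` over `j`. Based at the terminal point `s b`, it vanishes
at `j = b`, and replacing `A j` by `A (j + 1)` costs at most `L ‖ΔA‖` times the distance to `s b`,
which is at most `δ`. -/
theorem abs_sum_integral_sub_le (hg : Continuous g) {A : ℕ → Fin n → ℝ} {s : ℕ → ℝ}
    {v : ℕ → ℝ} {R L δ : ℝ} (hL0 : 0 ≤ L)
    (hL : ∀ a b : Fin n → ℝ, ∀ x : ℝ, ‖a‖ ≤ R → ‖b‖ ≤ R → |x| ≤ R →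
      |g (a, x) - g (b, x)| ≤ L * ‖a - b‖) {a b : ℕ} (hab : a ≤ b)
    (hA : ∀ j ∈ Finset.Icc a b, ‖A j‖ ≤ R) (hs : ∀ j ∈ Finset.Icc a b, |s j| ≤ R)
    (hδ : ∀ j ∈ Finset.Icc a b, |s j - s b| ≤ δ)
    (hv : ∀ j ∈ Finset.Ico a b, ‖A (j + 1) - A j‖ ≤ v (j + 1) - v j) :
    |∑ j ∈ Finset.Ico a b, (∫ z in s j..s (j + 1), g (A j, z)) -
      ∫ z in s a..s b, g (A a, z)| ≤ L * δ * (v b - v a) := by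
  have hi : ∀ j x y, IntervalIntegrable (fun z => g (A j, z)) volume x y := fun j x y =>
    Continuous.intervalIntegrable (hg.comp (by fun_prop)) _ _
  have htel : ∀ f : ℕ → ℝ, ∑ j ∈ Finset.Ico a b, (f (j + 1) - f j) = f b - f a := fun f => by
    rw [Finset.sum_Ico_eq_sub _ hab, Finset.sum_range_sub, Finset.sum_range_sub]; ring
  have h1 := htel fun j => ∫ z in s b..s j, g (A j, z)
  have h2 : ∀ j, (∫ z in s b..s (j + 1), g (A (j + 1), z)) - (∫ z in s b..s j, g (A j, z)) =
      (∫ z in s j..s (j + 1), g (A j, z)) +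
        ∫ z in s b..s (j + 1), (g (A (j + 1), z) - g (A j, z)) := by
    intro j
    rw [intervalIntegral.integral_sub (hi _ _ _) (hi _ _ _),
      ← intervalIntegral.integral_add_adjacent_intervals (hi j (s b) (s j)) (hi j _ (s (j + 1)))]
    ring
  simp only [h2, Finset.sum_add_distrib, intervalIntegral.integral_same, zero_sub,
    ← intervalIntegral.integral_symm] at h1
  rw [← h1, sub_add_cancel_left, abs_neg, ← htel v, Finset.mul_sum]
  refine (Finset.abs_sum_le_sum_abs _ _).trans (Finset.sum_le_sum fun j hj => ?_)
  have hj1 := Finset.mem_Ico.1 hj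
  have hm : j ∈ Finset.Icc a b := Finset.mem_Icc.2 ⟨hj1.1, hj1.2.le⟩
  have hm1 : j + 1 ∈ Finset.Icc a b := Finset.mem_Icc.2 ⟨by omega, by omega⟩
  have hmb : b ∈ Finset.Icc a b := Finset.mem_Icc.2 ⟨hab, le_rfl⟩
  have h3 := intervalIntegral.norm_integral_le_of_norm_le_const (a := s b) (b := s (j + 1))
    (f := fun z => g (A (j + 1), z) - g (A j, z)) (C := L * ‖A (j + 1) - A j‖)
    fun z hz => hL _ _ z (hA _ hm1) (hA _ hm)
      (abs_le.2 (uIcc_subset_Icc (abs_le.1 (hs _ hmb)) (abs_le.1 (hs _ hm1))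
        (uIoc_subset_uIcc hz)))
  refine h3.trans ?_
  calc L * ‖A (j + 1) - A j‖ * |s (j + 1) - s b|
      ≤ L * (v (j + 1) - v j) * δ :=
        mul_le_mul (mul_le_mul_of_nonneg_left (hv j hj) hL0) (hδ _ hm1) (abs_nonneg _)
          (mul_nonneg hL0 ((norm_nonneg _).trans (hv j hj)))
    _ = _ := by ring

/-- Comparison of the left Riemann sum of `g (A, s)` against `s` over a block with its second
order approximation at the beginning of the block. -/
theorem abs_sum_block_sub_le (hg : Continuous g) {A : ℕ → Fin n → ℝ} {s : ℕ → ℝ}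
    {v : ℕ → ℝ} {R L δ ε : ℝ} (hL0 : 0 ≤ L)
    (hL : ∀ a b : Fin n → ℝ, ∀ x : ℝ, ‖a‖ ≤ R → ‖b‖ ≤ R → |x| ≤ R →
      |g (a, x) - g (b, x)| ≤ L * ‖a - b‖) {a b : ℕ} (hab : a ≤ b)
    (hA : ∀ j ∈ Finset.Icc a b, ‖A j‖ ≤ R) (hs : ∀ j ∈ Finset.Icc a b, |s j| ≤ R)
    (hδ : ∀ j ∈ Finset.Icc a b, |s j - s b| ≤ δ)
    (hv : ∀ j ∈ Finset.Ico a b, ‖A (j + 1) - A j‖ ≤ v (j + 1) - v j)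
    (hT : ∀ j ∈ Finset.Icc a b, ∀ k ∈ Finset.Icc a b,
      |(∫ z in s j..s k, g (A j, z)) - g (A j, s j) * (s k - s j) -
        derivLast g (A j, s j) / 2 * (s k - s j) ^ 2| ≤ ε * (s k - s j) ^ 2)
    (hp : ∀ j ∈ Finset.Icc a b, |derivLast g (A j, s j) - derivLast g (A a, s a)| ≤ ε) :
    |∑ j ∈ Finset.Ico a b, g (A j, s j) * (s (j + 1) - s j) - g (A a, s a) * (s b - s a) -
      derivLast g (A a, s a) / 2 * ((s b - s a) ^ 2 -
        ∑ j ∈ Finset.Ico a b, (s (j + 1) - s j) ^ 2)| ≤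
      L * δ * (v b - v a) + ε * (s b - s a) ^ 2 +
        2 * ε * ∑ j ∈ Finset.Ico a b, (s (j + 1) - s j) ^ 2 := by
  have h1 := abs_sum_integral_sub_le hg hL0 hL hab hA hs hδ hv
  have hma : a ∈ Finset.Icc a b := Finset.mem_Icc.2 ⟨le_rfl, hab⟩
  have h2 := hT a hma b (Finset.mem_Icc.2 ⟨hab, le_rfl⟩)
  have h3 : |∑ j ∈ Finset.Ico a b, ((∫ z in s j..s (j + 1), g (A j, z)) -
      g (A j, s j) * (s (j + 1) - s j) -
        derivLast g (A a, s a) / 2 * (s (j + 1) - s j) ^ 2)| ≤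
      ∑ j ∈ Finset.Ico a b, 2 * ε * (s (j + 1) - s j) ^ 2 := by
    refine (Finset.abs_sum_le_sum_abs _ _).trans (Finset.sum_le_sum fun j hj => ?_)
    have hj1 := Finset.mem_Ico.1 hj
    have hm : j ∈ Finset.Icc a b := Finset.mem_Icc.2 ⟨hj1.1, hj1.2.le⟩
    have hm1 : j + 1 ∈ Finset.Icc a b := Finset.mem_Icc.2 ⟨by omega, by omega⟩
    have h4 := hT j hm _ hm1
    have h5 := mul_le_mul_of_nonneg_right (hp j hm) (sq_nonneg (s (j + 1) - s j))
    rw [← abs_of_nonneg (sq_nonneg (s (j + 1) - s j)), ← abs_mul,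
      abs_of_nonneg (sq_nonneg (s (j + 1) - s j))] at h5
    rw [abs_le] at h4 h5 ⊢
    constructor <;> linarith [h4.1, h4.2, h5.1, h5.2]
  rw [← Finset.mul_sum, Finset.sum_sub_distrib, Finset.sum_sub_distrib, ← Finset.mul_sum] at h3
  rw [abs_le] at h1 h2 h3 ⊢
  constructor <;> linarith [h1.1, h1.2, h2.1, h2.2, h3.1, h3.2]

end Taylor

/-! ### Local increments of Itô and Stieltjes integrals. -/

section Increments

variable {P : RefiningGrids} {S ξ X : ℝ → ℝ} {T : ℝ}

theorem negligible_of_eventually_le_mul {e f : ℕ → ℕ → ℝ} (hf : SumBounded P T f)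
    (h : ∀ ε > 0, ∀ᶠ N in atTop, ∀ i ∈ (P.grid N).indices T, |e N i| ≤ ε * |f N i|) :
    Negligible P T e := by
  obtain ⟨K, hK⟩ := hf
  rw [Negligible, Metric.tendsto_nhds]
  intro ε hε
  filter_upwards [h (ε / (|K| + 1)) (by positivity)] with N hN
  rw [Real.dist_eq, sub_zero, abs_of_nonneg (Finset.sum_nonneg fun i _ => abs_nonneg _)]
  refine (Finset.sum_le_sum hN).trans_lt ?_
  rw [← Finset.mul_sum]
  calc ε / (|K| + 1) * ∑ i ∈ (P.grid N).indices T, |f N i| ≤ ε / (|K| + 1) * |K| :=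
        mul_le_mul_of_nonneg_left ((hK N).trans (le_abs_self K)) (by positivity)
    _ < ε := by
        rw [div_mul_eq_mul_div, div_lt_iff₀ (by positivity)]
        nlinarith [abs_nonneg K]

/-- A continuous vector-valued path with components of bounded variation is dominated by a monotone
function. -/
theorem exists_dominating_variation {n : ℕ} {A : ℝ → Fin n → ℝ} (hT : 0 ≤ T)
    (hA : ∀ k, BoundedVariationOn (fun t => A t k) (Icc 0 T)) :
    ∃ V : ℝ → ℝ, ∀ u ∈ Icc 0 T, ∀ v ∈ Icc 0 T, u ≤ v → ‖A v - A u‖ ≤ V v - V u := by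
  refine ⟨fun t => ∑ k, variationOnFromTo (fun t => A t k) (Icc 0 T) 0 t,
    fun u hu v hv huv => ?_⟩
  have h : ∀ k, |A v k - A u k| ≤ variationOnFromTo (fun t => A t k) (Icc 0 T) 0 v -
      variationOnFromTo (fun t => A t k) (Icc 0 T) 0 u := fun k =>
    variationOnFromTo.abs_sub_le_sub_of_le (hA k).locallyBoundedVariationOn ⟨le_rfl, hT⟩ hu hv huv
  rw [← Finset.sum_sub_distrib, pi_norm_le_iff_of_nonneg
    (Finset.sum_nonneg fun k _ => (abs_nonneg _).trans (h k))]
  intro k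
  exact (h k).trans (Finset.single_le_sum
    (f := fun k => variationOnFromTo (fun t => A t k) (Icc 0 T) 0 v -
      variationOnFromTo (fun t => A t k) (Icc 0 T) 0 u)
    (fun k _ => (abs_nonneg _).trans (h k)) (Finset.mem_univ k))

/-- The grid points of a finer grid in a block of a coarser grid. -/
theorem exists_block (P : RefiningGrids) {M N : ℕ} (h : M ≤ N) (i : ℕ) :
    ∃ a b, a ≤ b ∧ (P.grid N).pt a = (P.grid M).pt i ∧ (P.grid N).pt b = (P.grid M).pt (i + 1) := by
  obtain ⟨a, ha⟩ := P.exists_pt_eq h i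
  obtain ⟨b, hb⟩ := P.exists_pt_eq h (i + 1)
  refine ⟨a, b, ?_, ha, hb⟩
  rw [← (P.grid N).strictMono.le_iff_le, ha, hb]
  exact (P.grid M).pt_le_pt_succ i

/-- The increments of an Itô integral, up to an array whose absolute sum is negligible. -/
theorem exists_negligible_ito_increment (hSc : ContinuousOn S (Ici 0))
    (hq : HasContinuousQuadVar P S) (hT : 0 < T) (hξ : IsAdmissibleIntegrand S ξ)
    (hX : ∀ t ∈ Icc 0 T, HasItoIntegral P ξ S t (X t)) :
    ∃ p : ℝ → ℝ, ContinuousOn p (Icc 0 T) ∧ Negligible P T fun N i =>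
      inc P X N i - val P ξ N i * inc P S N i -
        val P p N i * (inc P S N i ^ 2 - inc P (quadVar P S) N i) := by
  obtain ⟨n, g, A, hg, hAc, hAv, hξ⟩ := hξ T hT
  obtain ⟨V, hV⟩ := exists_dominating_variation hT.le hAv
  have hAc' : ContinuousOn A (Icc 0 T) := hAc.mono Icc_subset_Ici_self
  have hSc' : ContinuousOn S (Icc 0 T) := hSc.mono Icc_subset_Ici_self
  obtain ⟨R₁, hR₁⟩ := isCompact_Icc.exists_bound_of_continuousOn hAc'
  obtain ⟨R₂, hR₂⟩ := isCompact_Icc.exists_bound_of_continuousOn hSc'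
  obtain ⟨L, hL0, hL⟩ := exists_lipschitz_first hg (max R₁ R₂)
  have hpc : ContinuousOn (fun t => derivLast g (A t, S t)) (Icc 0 T) :=
    (continuous_derivLast hg).comp_continuousOn (hAc'.prodMk hSc')
  refine ⟨fun t => derivLast g (A t, S t) / 2, hpc.div_const 2, ?_⟩
  have hVb : SumBounded P T (inc P V) := sumBounded_inc (V := V) hT.le fun u hu v hv huv =>
    (abs_of_nonneg ((norm_nonneg _).trans (hV u hu v hv huv))).le
  -- The three summands match the three error terms of `abs_sum_block_sub_le`, with block sums of
  -- squares replaced by their limit `Δ[S]`.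
  refine negligible_of_eventually_le_mul ((hVb.add (hq.sumBounded hT.le)).add
    ((hq.sumBounded_inc hT.le).const_mul 2)) fun ε hε => ?_
  obtain ⟨δ₁, hδ₁, hTay⟩ := exists_taylor_modulus hg (max R₁ R₂) hε
  -- The bound `ε / (L + 1)` absorbs the Lipschitz constant in the variation term. All moduli are
  -- uniform on `[0, T]`, so the estimate holds for all intervals at once.
  obtain ⟨δ₂, hδ₂, hmodS⟩ := exists_modulus hSc' (ε := min δ₁ (ε / (L + 1)))
    (lt_min hδ₁ (by positivity))
  obtain ⟨δ₃, hδ₃, hmodp⟩ := exists_modulus hpc hε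
  obtain ⟨N₀, hN₀⟩ := eventually_atTop.1 (P.eventually_step_lt (lt_min hδ₂ hδ₃))
  filter_upwards [eventually_ge_atTop N₀] with N hN i hi
  have hu := TimeGrid.pt_mem_Icc hi
  have hv := TimeGrid.pt_succ_mem_Icc hi
  have huv := (P.grid N).pt_le_pt_succ i
  have hstep := hN₀ N hN i
  have hVi : 0 ≤ inc P V N i := (norm_nonneg _).trans (hV _ hu _ hv huv)
  have hqi : 0 ≤ inc P (quadVar P S) N i := sub_nonneg.2 (hq.mono hu.1 huv)
  have hnn : 0 ≤ inc P V N i + inc P S N i ^ 2 + 2 * inc P (quadVar P S) N i := by positivity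
  rw [abs_of_nonneg hnn]
  set u := (P.grid N).pt i
  set v := (P.grid N).pt (i + 1)
  -- The coarse interval `[u, v]` stays fixed while the inner grid `M` is refined; the block
  -- estimate passes to the limit, where sums become increments of `X` and of `[S]`.
  have hlim : Tendsto (fun M => |(∑ j ∈ (P.grid M).indices v, val P ξ M j * inc P S M j -
      ∑ j ∈ (P.grid M).indices u, val P ξ M j * inc P S M j) - ξ u * (S v - S u) -
      derivLast g (A u, S u) / 2 * ((S v - S u) ^ 2 - (∑ j ∈ (P.grid M).indices v,
        inc P S M j ^ 2 - ∑ j ∈ (P.grid M).indices u, inc P S M j ^ 2))|) atTop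
      (𝓝 |(X v - X u) - ξ u * (S v - S u) - derivLast g (A u, S u) / 2 * ((S v - S u) ^ 2 -
        (quadVar P S v - quadVar P S u))|) :=
    ((((hX v hv).sub (hX u hu)).sub_const _).sub
      ((((hq.tendsto hv.1).sub (hq.tendsto hu.1)).const_sub _).const_mul _)).abs
  have hlim' : Tendsto (fun M => ε * (V v - V u) + ε * (S v - S u) ^ 2 +
      2 * ε * (∑ j ∈ (P.grid M).indices v, inc P S M j ^ 2 -
        ∑ j ∈ (P.grid M).indices u, inc P S M j ^ 2)) atTop
      (𝓝 (ε * (V v - V u) + ε * (S v - S u) ^ 2 + 2 * ε * (quadVar P S v - quadVar P S u))) :=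
    (((hq.tendsto hv.1).sub (hq.tendsto hu.1)).const_mul _).const_add _
  have hle := le_of_tendsto_of_tendsto hlim hlim' ?_
  · refine (le_of_eq ?_).trans (hle.trans (le_of_eq ?_))
    · rfl
    · simp only [inc]; ring
  filter_upwards [eventually_ge_atTop N] with M hM
  obtain ⟨a, b, hab, ha, hb⟩ := exists_block P hM i
  change (P.grid M).pt a = u at ha
  change (P.grid M).pt b = v at hb
  have hmem : ∀ j ∈ Finset.Icc a b, (P.grid M).pt j ∈ Icc u v := fun j hj =>
    ⟨ha ▸ (P.grid M).pt_mono (Finset.mem_Icc.1 hj).1, hb ▸ (P.grid M).pt_mono (Finset.mem_Icc.1 hj).2⟩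
  have hmem' : ∀ j ∈ Finset.Icc a b, (P.grid M).pt j ∈ Icc 0 T := fun j hj =>
    ⟨hu.1.trans (hmem j hj).1, (hmem j hj).2.trans hv.2⟩
  have hclose : ∀ j ∈ Finset.Icc a b, ∀ k ∈ Finset.Icc a b,
      |(P.grid M).pt j - (P.grid M).pt k| < min δ₂ δ₃ := by
    intro j hj k hk
    have h1 := hmem j hj
    have h2 := hmem k hk
    rw [abs_lt]
    constructor <;> linarith [h1.1, h1.2, h2.1, h2.2]
  have hS' : ∀ j ∈ Finset.Icc a b, ∀ k ∈ Finset.Icc a b,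
      |S ((P.grid M).pt j) - S ((P.grid M).pt k)| < min δ₁ (ε / (L + 1)) := fun j hj k hk =>
    hmodS _ (hmem' j hj) _ (hmem' k hk) ((hclose j hj k hk).trans_le (min_le_left _ _))
  have hAR : ∀ j ∈ Finset.Icc a b, ‖A ((P.grid M).pt j)‖ ≤ max R₁ R₂ := fun j hj =>
    (hR₁ _ (hmem' j hj)).trans (le_max_left _ _)
  have hSR : ∀ j ∈ Finset.Icc a b, |S ((P.grid M).pt j)| ≤ max R₁ R₂ := fun j hj =>
    (hR₂ _ (hmem' j hj)).trans (le_max_right _ _)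
  have hmb : b ∈ Finset.Icc a b := Finset.mem_Icc.2 ⟨hab, le_rfl⟩
  have hma : a ∈ Finset.Icc a b := Finset.mem_Icc.2 ⟨le_rfl, hab⟩
  have hblock := abs_sum_block_sub_le hg.continuous (A := fun j => A ((P.grid M).pt j))
    (s := fun j => S ((P.grid M).pt j)) (v := fun j => V ((P.grid M).pt j)) (δ := ε / (L + 1))
    (ε := ε) hL0 hL hab hAR hSR
    (fun j hj => (hS' j hj b hmb).le.trans (min_le_right _ _))
    (fun j hj => by
      have hj1 := Finset.mem_Ico.1 hj
      exact hV _ (hmem' j (Finset.mem_Icc.2 ⟨hj1.1, hj1.2.le⟩)) _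
        (hmem' (j + 1) (Finset.mem_Icc.2 ⟨by omega, by omega⟩)) ((P.grid M).pt_le_pt_succ j))
    (fun j hj k hk => hTay _ _ _ (hAR j hj) (hSR j hj) (hSR k hk)
      ((hS' k hk j hj).trans_le (min_le_left _ _)))
    (fun j hj => (hmodp _ (hmem' j hj) _ (hmem' a hma)
      ((hclose j hj a hma).trans_le (min_le_right _ _))).le)
  have hξj : ∑ j ∈ Finset.Ico a b, val P ξ M j * inc P S M j = ∑ j ∈ Finset.Ico a b,
      g (A ((P.grid M).pt j), S ((P.grid M).pt j)) *
        (S ((P.grid M).pt (j + 1)) - S ((P.grid M).pt j)) := by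
    refine Finset.sum_congr rfl fun j hj => ?_
    have hj1 := Finset.mem_Ico.1 hj
    rw [val, hξ _ (hmem' j (Finset.mem_Icc.2 ⟨hj1.1, hj1.2.le⟩)), inc]
  have hsum : ∀ f : ℕ → ℝ, ∑ j ∈ (P.grid M).indices v, f j - ∑ j ∈ (P.grid M).indices u, f j =
      ∑ j ∈ Finset.Ico a b, f j := fun f => by
    rw [← ha, ← hb]
    exact (P.grid M).sum_indices_pt_sub f hab
  rw [hsum, hsum, hξj, hξ u hu]
  simp only [ha, hb] at hblock
  refine hblock.trans ?_
  have hLε : L * (ε / (L + 1)) ≤ ε := by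
    rw [mul_div_assoc', div_le_iff₀ (by positivity)]
    nlinarith
  have := mul_le_mul_of_nonneg_right hLε ((norm_nonneg _).trans (hV _ hu _ hv huv))
  simp only [inc]
  linarith

/-- The increments of a Stieltjes integral, given as a limit of Riemann sums, up to an array
whose absolute sum is negligible. -/
theorem negligible_stieltjes_increment {η F Y V : ℝ → ℝ} (hT : 0 ≤ T)
    (hη : ContinuousOn η (Icc 0 T))
    (hV : ∀ u ∈ Icc 0 T, ∀ v ∈ Icc 0 T, u ≤ v → |F v - F u| ≤ V v - V u)
    (hY : ∀ t ∈ Icc 0 T, Tendsto (fun N => ∑ i ∈ (P.grid N).indices t,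
      val P η N i * inc P F N i) atTop (𝓝 (Y t))) :
    Negligible P T fun N i => inc P Y N i - val P η N i * inc P F N i := by
  have hVb : SumBounded P T (inc P V) := sumBounded_inc (V := V) hT fun u hu v hv huv =>
    (abs_of_nonneg ((abs_nonneg _).trans (hV u hu v hv huv))).le
  refine negligible_of_eventually_le_mul hVb fun ε hε => ?_
  obtain ⟨δ, hδ, hmod⟩ := exists_modulus hη hε
  filter_upwards [P.eventually_step_lt hδ] with N hN i hi
  have hu := TimeGrid.pt_mem_Icc hi
  have hv := TimeGrid.pt_succ_mem_Icc hi
  have huv := (P.grid N).pt_le_pt_succ i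
  have hstep := hN i
  rw [abs_of_nonneg (a := inc P V N i) ((abs_nonneg _).trans (hV _ hu _ hv huv))]
  simp only [inc, val]
  set u := (P.grid N).pt i
  set v := (P.grid N).pt (i + 1)
  -- Again the estimate is proved on finer grids `M` inside the fixed interval, and the limit in `M`
  -- is taken.
  refine le_of_tendsto (((hY v hv).sub (hY u hu)).sub_const _).abs ?_
  filter_upwards [eventually_ge_atTop N] with M hM
  obtain ⟨a, b, hab, ha, hb⟩ := exists_block P hM i
  change (P.grid M).pt a = u at ha
  change (P.grid M).pt b = v at hb
  have hsum := (P.grid M).sum_indices_pt_sub (fun j => val P η M j * inc P F M j) hab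
  have htel : ∀ f : ℝ → ℝ, ∑ j ∈ Finset.Ico a b, (f ((P.grid M).pt (j + 1)) - f ((P.grid M).pt j)) =
      f v - f u := fun f => by
    rw [Finset.sum_Ico_eq_sub _ hab, Finset.sum_range_sub (fun j => f ((P.grid M).pt j)),
      Finset.sum_range_sub (fun j => f ((P.grid M).pt j)), ha, hb]
    ring
  rw [ha, hb] at hsum
  rw [hsum, ← htel F, ← htel V, Finset.mul_sum, Finset.mul_sum, ← Finset.sum_sub_distrib]
  refine (Finset.abs_sum_le_sum_abs _ _).trans (Finset.sum_le_sum fun j hj => ?_)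
  have hj1 := Finset.mem_Ico.1 hj
  have h1 : u ≤ (P.grid M).pt j := ha ▸ (P.grid M).pt_mono hj1.1
  have h2 : (P.grid M).pt (j + 1) ≤ v := hb ▸ (P.grid M).pt_mono hj1.2
  have h3 := (P.grid M).pt_le_pt_succ j
  have hj' : (P.grid M).pt j ∈ Icc 0 T := ⟨hu.1.trans h1, h3.trans (h2.trans hv.2)⟩
  simp only [val, inc]
  rw [← sub_mul, abs_mul]
  refine mul_le_mul (hmod _ hj' _ hu ?_).le (hV _ hj' _ ⟨hj'.1.trans h3, h2.trans hv.2⟩ h3)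
    (abs_nonneg _) hε.le
  rw [abs_of_nonneg (sub_nonneg.2 h1)]
  linarith

end Increments

/-! ### A CPPI cushion divided by the explicit exponential is constant. -/

section Uniqueness

variable {P : RefiningGrids} {r S ξ η : ℝ → ℝ} {V₀ α m T : ℝ}

theorem UnifBounded.add {e f : ℕ → ℕ → ℝ} (he : UnifBounded P T e) (hf : UnifBounded P T f) :
    UnifBounded P T (fun N i => e N i + f N i) := by
  obtain ⟨K, hK⟩ := he
  obtain ⟨L, hL⟩ := hf
  exact ⟨K + L, fun N i hi => (abs_add_le _ _).trans (add_le_add (hK N i hi) (hL N i hi))⟩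

theorem IsAdmissibleIntegrand.continuousOn (h : IsAdmissibleIntegrand S ξ)
    (hS : ContinuousOn S (Ici 0)) : ContinuousOn ξ (Ici 0) := by
  intro x hx
  have hx1 : (0 : ℝ) < x + 1 := by linarith [mem_Ici.1 hx]
  obtain ⟨n, g, A, hg, hA, -, hξ⟩ := h (x + 1) hx1
  have hc : ContinuousOn ξ (Icc 0 (x + 1)) :=
    (hg.continuous.comp_continuousOn ((hA.prodMk hS).mono Icc_subset_Ici_self)).congr hξ
  refine (hc x ⟨hx, by linarith⟩).mono_of_mem_nhdsWithin ?_
  rw [← Ici_inter_Iic]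
  exact inter_mem_nhdsWithin _ (Iic_mem_nhds (lt_add_one x))

/-- The cushion of a portfolio. -/
def cushion (r S ξ η : ℝ → ℝ) (V₀ α t : ℝ) : ℝ :=
  portfolioValue r S ξ η t - α * V₀ * bond r t

theorem FollowsCPPI.stock_eq_cushion (h : FollowsCPPI r S V₀ α m ξ η) {t : ℝ} (ht : 0 ≤ t) :
    ξ t = m * cushion r S ξ η V₀ α t / S t := h.stock_eq t ht

theorem FollowsCPPI.bond_eq_cushion (h : FollowsCPPI r S V₀ α m ξ η) {t : ℝ} (ht : 0 ≤ t) :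
    η t = ((1 - m) * cushion r S ξ η V₀ α t + α * V₀ * bond r t) / bond r t := by
  rw [h.bond_eq' t ht, cushion]
  congr 1
  ring

/-- Continuity of the value is not part of the definition of a strategy. It is recovered from the
admissible `ξ` by solving the CPPI rule for the cushion, which uses `m ≠ 0`. -/
theorem continuousOn_cushion (hS : IsPricePath P S) (hm : m ≠ 0)
    (hsf : IsSelfFinancing P r S ξ η) (h : FollowsCPPI r S V₀ α m ξ η) :
    ContinuousOn (cushion r S ξ η V₀ α) (Ici 0) := by
  refine (((hsf.admissible.continuousOn hS.continuousOn).mul hS.continuousOn).div_const m).congr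
    fun t ht => ?_
  have := (hS.pos t ht).ne'
  show cushion r S ξ η V₀ α t = ξ t * S t / m
  rw [h.stock_eq_cushion ht]
  field_simp

/-- The increments of the value of a self-financing strategy, up to an array whose absolute sum
is negligible. -/
theorem IsSelfFinancing.exists_negligible_increment (hsf : IsSelfFinancing P r S ξ η)
    (hS : IsPricePath P S) (hr : IsShortRate r) (hη : ContinuousOn η (Ici 0)) (hT : 0 < T) :
    ∃ p : ℝ → ℝ, ContinuousOn p (Icc 0 T) ∧ Negligible P T fun N i =>
      inc P (portfolioValue r S ξ η) N i - val P ξ N i * inc P S N i -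
        val P η N i * inc P (bond r) N i -
        val P p N i * (inc P S N i ^ 2 - inc P (quadVar P S) N i) := by
  choose! I J hI hJ hV using hsf.value_eq
  obtain ⟨p, hp, h1⟩ := exists_negligible_ito_increment hS.continuousOn hS.quadVar hT
    hsf.admissible fun t ht => hI t ht.1
  obtain ⟨W, hW⟩ := exists_abs_bond_sub_le hr T
  have h2 := negligible_stieltjes_increment (P := P) (Y := J) hT.le
    (hη.mono Icc_subset_Ici_self) hW fun t ht =>
      (hJ t ht.1).tendsto hr ht.1 (hη.mono Icc_subset_Ici_self)
  refine ⟨p, hp, (h1.add h2).congr fun N i hi => ?_⟩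
  have h3 := hV _ ((P.grid N).pt_nonneg i)
  have h4 := hV _ ((P.grid N).pt_nonneg (i + 1))
  simp only [inc] at h3 h4 ⊢
  rw [h3, h4]
  ring

/-- The product of the simple returns of a CPPI cushion and of the inverse of the normalised
cushion agrees with `-m²` times the squared increment of the logarithm of the price. -/
theorem negligible_cross_return (hS : IsPricePath P S) (hr : IsShortRate r) (m : ℝ) (hT : 0 ≤ T) :
    Negligible P T fun N i => (Real.exp (-inc P (logCushion P r S m) N i) - 1) *
      (m * inc P (logPrice S) N i + m / 2 * inc P (logPrice S) N i ^ 2 +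
        (1 - m) * inc P (logBond r) N i) + m ^ 2 * inc P (logPrice S) N i ^ 2 := by
  have hlc : ContinuousOn (logPrice S) (Icc 0 T) := hS.continuousOn_log.mono Icc_subset_Ici_self
  have hbc : ContinuousOn (logBond r) (Icc 0 T) :=
    (continuousOn_logBond hr).mono Icc_subset_Ici_self
  have hls := unifSmall_inc (P := P) hlc
  have hlb := unifBounded_inc (P := P) hlc
  have hbs := unifSmall_inc (P := P) hbc
  have hbb := unifBounded_inc (P := P) hbc
  have hq := hS.quadVar_log.sumBounded hT
  have hwb := ((UnifBounded.mul (unifBounded_const m) hlb).add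
    ((unifBounded_const (m / 2)).mul (hlb.mul hlb))).add ((unifBounded_const (1 - m)).mul hbb)
  have hws := ((hls.const_mul m).add ((hlb.mul_unifSmall hls).const_mul (m / 2))).add
    (hbs.const_mul (1 - m))
  -- Let `w` be the second factor, the cushion return. As `exp(-y) - 1` is `-y + m² l² / 2` up to a
  -- negligible array, the product with `w` splits into three negligible parts and `-m² l²`.
  have h1 := hws.mul_sumBounded ((hq.const_mul (m ^ 2 / 2)).sub
    (sumBounded_inc_cushionDrift hS hr m hT))
  have h2 := hwb.mul_negligible (negligible_inv_cushion_return hS hr hT m)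
  have h3 := (hls.const_mul m).mul_sumBounded ((hq.const_mul (m / 2)).add
    ((sumBounded_inc_logBond (P := P) hr hT).const_mul (1 - m)))
  refine ((h1.add h2).sub h3).congr fun N i _ => ?_
  rw [inc_logCushion]
  ring

/-- Product rule for `K` and `Z = exp(-Y)`. The `l²` coefficients `m / 2` from `Z ΔK`, `m² / 2` from
`K ΔZ` and `-m²` from `ΔK ΔZ` add up to `-½ m (m - 1)`. The two compensated squares are kept apart
with weights at the left endpoint, since their sums vanish only through cancellation; everything
else is negligible. The factor `val + inc` is `Z` at the right endpoint. -/
theorem inc_discounted_cushion_eq (hS : IsPricePath P S) (h : FollowsCPPI r S V₀ α m ξ η)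
    (p : ℝ → ℝ) (N i : ℕ) :
    inc P (fun t => cushion r S ξ η V₀ α t * Real.exp (-logCushion P r S m t)) N i =
      val P (fun t => Real.exp (-logCushion P r S m t) * p t) N i *
        (inc P S N i ^ 2 - inc P (quadVar P S) N i) +
      -(1 / 2) * m * (m - 1) *
        (val P (fun t => Real.exp (-logCushion P r S m t) * cushion r S ξ η V₀ α t) N i *
          (inc P (logPrice S) N i ^ 2 - inc P (quadVar P (logPrice S)) N i)) +
      (inc P (fun t => Real.exp (-logCushion P r S m t)) N i *
          (val P p N i * (inc P S N i ^ 2 - inc P (quadVar P S) N i)) +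
        val P (fun t => Real.exp (-logCushion P r S m t) * cushion r S ξ η V₀ α t) N i *
          ((Real.exp (-inc P (logCushion P r S m) N i) - 1 +
            inc P (logCushion P r S m) N i - m ^ 2 / 2 * inc P (logPrice S) N i ^ 2) +
          ((Real.exp (-inc P (logCushion P r S m) N i) - 1) *
            (m * inc P (logPrice S) N i + m / 2 * inc P (logPrice S) N i ^ 2 +
              (1 - m) * inc P (logBond r) N i) + m ^ 2 * inc P (logPrice S) N i ^ 2)) +
        (val P (fun t => Real.exp (-logCushion P r S m t)) N i +
          inc P (fun t => Real.exp (-logCushion P r S m t)) N i) *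
          ((inc P (portfolioValue r S ξ η) N i - val P ξ N i * inc P S N i -
              val P η N i * inc P (bond r) N i -
              val P p N i * (inc P S N i ^ 2 - inc P (quadVar P S) N i)) +
            val P (cushion r S ξ η V₀ α) N i *
              (m * (Real.exp (inc P (logPrice S) N i) - 1 - inc P (logPrice S) N i -
                inc P (logPrice S) N i ^ 2 / 2) +
              (1 - m) * (Real.exp (inc P (logBond r) N i) - 1 - inc P (logBond r) N i)))) := by
  have hp := (P.grid N).pt_nonneg i
  have hZ : inc P (fun t => Real.exp (-logCushion P r S m t)) N i =
      Real.exp (-logCushion P r S m ((P.grid N).pt i)) *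
        (Real.exp (-inc P (logCushion P r S m) N i) - 1) := by
    rw [inc_exp P (fun t => -logCushion P r S m t)]
    congr 3
    simp only [inc]; ring
  have hξ : val P ξ N i * inc P S N i = m * val P (cushion r S ξ η V₀ α) N i *
      (Real.exp (inc P (logPrice S) N i) - 1) := by
    have h1 := (hS.pos _ hp).ne'
    rw [hS.inc_eq, val, h.stock_eq_cushion hp, val]
    field_simp
  have hη : val P η N i * inc P (bond r) N i = (1 - m) * val P (cushion r S ξ η V₀ α) N i *
      (Real.exp (inc P (logBond r) N i) - 1) + α * V₀ * inc P (bond r) N i := by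
    have h1 := (bond_pos r ((P.grid N).pt i)).ne'
    rw [inc_bond, val, h.bond_eq_cushion hp, val]
    field_simp
  have hV : inc P (portfolioValue r S ξ η) N i =
      inc P (cushion r S ξ η V₀ α) N i + α * V₀ * inc P (bond r) N i := by
    simp only [inc, cushion]; ring
  have hH : inc P (fun t => cushion r S ξ η V₀ α t * Real.exp (-logCushion P r S m t)) N i =
      val P (fun t => Real.exp (-logCushion P r S m t)) N i * inc P (cushion r S ξ η V₀ α) N i +
      val P (cushion r S ξ η V₀ α) N i * inc P (fun t => Real.exp (-logCushion P r S m t)) N i +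
      inc P (fun t => Real.exp (-logCushion P r S m t)) N i *
        inc P (cushion r S ξ η V₀ α) N i := by
    simp only [inc, val]; ring
  rw [hH, hξ, hη, hV, hZ, inc_logCushion, inc_cushionDrift]
  simp only [val]
  ring

/-- The cushion of a self-financing strategy following the CPPI rules is determined. -/
theorem cushion_eq_cppiCushion (hS : IsPricePath P S) (hr : IsShortRate r) (hm : m ≠ 0)
    (hsf : IsSelfFinancing P r S ξ η) (h : FollowsCPPI r S V₀ α m ξ η) (hT : 0 ≤ T) :
    cushion r S ξ η V₀ α T = cppiCushion P r S V₀ α m T := by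
  have h0 : cushion r S ξ η V₀ α 0 = (1 - α) * V₀ := by
    rw [cushion, h.initial, bond_zero]; ring
  rcases hT.eq_or_lt with rfl | hT
  · rw [h0, cppiCushion_zero hS]
  have hKc := continuousOn_cushion hS hm hsf h
  have hηc : ContinuousOn η (Ici 0) :=
    (((hKc.const_mul (1 - m)).add ((continuousOn_bond hr).const_mul (α * V₀))).div
      (continuousOn_bond hr) fun t _ => (bond_pos r t).ne').congr fun t ht => h.bond_eq_cushion ht
  obtain ⟨p, hp, he⟩ := hsf.exists_negligible_increment hS hr hηc hT
  have hK : ContinuousOn (cushion r S ξ η V₀ α) (Icc 0 T) := hKc.mono Icc_subset_Ici_self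
  have hZ : ContinuousOn (fun t => Real.exp (-logCushion P r S m t)) (Icc 0 T) :=
    ((continuousOn_logCushion hS hr m).mono Icc_subset_Ici_self).neg.rexp
  have hq : SumBounded P T fun N i => val P p N i * (inc P S N i ^ 2 - inc P (quadVar P S) N i) :=
    (unifBounded_val hp).mul_sumBounded
      ((hS.quadVar.sumBounded hT.le).sub (hS.quadVar.sumBounded_inc hT.le))
  have hneg := (((unifSmall_inc hZ).mul_sumBounded hq).add
    ((unifBounded_val (P := P) (hZ.mul hK)).mul_negligible
      ((negligible_inv_cushion_return hS hr hT.le m).add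
        (negligible_cross_return hS hr m hT.le)))).add
    (((unifBounded_val (P := P) hZ).add (unifBounded_inc hZ)).mul_negligible
      (he.add ((unifBounded_val (P := P) hK).mul_negligible
        (((hS.negligible_return hT.le).const_mul m).add
          ((negligible_bond_return (P := P) hr hT.le).const_mul (1 - m))))))
  -- Both compensated sums have continuous weights and vanish. The same increments telescope to the
  -- change of `K Z` over `[0, T]`, which is therefore zero.
  have hsum := ((hS.quadVar.tendsto_sum_val_mul hT.le (hZ.mul hp)).add
    ((hS.quadVar_log.tendsto_sum_val_mul hT.le (hZ.mul hK)).const_mul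
      (-(1 / 2) * m * (m - 1)))).add hneg.tendsto_sum
  rw [mul_zero, add_zero, add_zero] at hsum
  have hlim := tendsto_sum_inc (P := P) hT.le (hK.mul hZ)
  have heq := tendsto_nhds_unique hlim (hsum.congr fun N => by
    rw [Finset.mul_sum, ← Finset.sum_add_distrib, ← Finset.sum_add_distrib]
    exact Finset.sum_congr rfl fun i _ => (inc_discounted_cushion_eq hS h p N i).symm)
  rw [Pi.mul_apply, Pi.mul_apply, h0, logCushion_zero, neg_zero, Real.exp_zero, mul_one, sub_eq_zero] at heq
  rw [cppiCushion_eq hS r V₀ α m hT.le, ← heq, mul_assoc, ← Real.exp_add, neg_add_cancel,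
    Real.exp_zero, mul_one]

theorem eq_cppi_of_followsCPPI (hS : IsPricePath P S) (hr : IsShortRate r) (hm : m ≠ 0)
    (hsf : IsSelfFinancing P r S ξ η) (h : FollowsCPPI r S V₀ α m ξ η) (hT : 0 ≤ T) :
    ξ T = cppiStock P r S V₀ α m T ∧ η T = cppiBond P r S V₀ α m T := by
  have hc := cushion_eq_cppiCushion hS hr hm hsf h hT
  refine ⟨by rw [h.stock_eq_cushion hT, hc, cppiStock], ?_⟩
  rw [h.bond_eq_cushion hT, hc, cppiBond, cppiValue]
  congr 1
  ring

end Uniqueness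

end PathwiseCPPI
end

open PathwiseCPPI in
theorem theorem2 (P : RefiningGrids) (r S : ℝ → ℝ)
    (hr : ∀ t : ℝ, 0 < t → IntegrableOn r (Icc 0 t))
    (hS_cont : ContinuousOn S (Ici 0)) (hS_pos : ∀ t : ℝ, 0 ≤ t → 0 < S t)
    (hS_qv : HasContinuousQuadVar P S)
    (V₀ α m : ℝ) (hV₀ : 0 ≤ V₀) (hα : α ∈ Icc (0 : ℝ) 1) (hm : 0 < m) :
    HasContinuousQuadVar P (fun t => Real.log (S t)) ∧
    IsSelfFinancing P r S (cppiStock P r S V₀ α m) (cppiBond P r S V₀ α m) ∧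
    (∀ t : ℝ, 0 ≤ t →
      portfolioValue r S (cppiStock P r S V₀ α m) (cppiBond P r S V₀ α m) t
        = cppiValue P r S V₀ α m t) ∧
    FollowsCPPI r S V₀ α m (cppiStock P r S V₀ α m) (cppiBond P r S V₀ α m) ∧
    (∀ t : ℝ, 0 ≤ t → α * V₀ * bond r t ≤ cppiValue P r S V₀ α m t) ∧
    (∀ ξ η : ℝ → ℝ, IsSelfFinancing P r S ξ η → FollowsCPPI r S V₀ α m ξ η →
      ∀ t : ℝ, 0 ≤ t → ξ t = cppiStock P r S V₀ α m t ∧ η t = cppiBond P r S V₀ α m t) := by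
  have hS : IsPricePath P S := ⟨hS_cont, hS_pos, hS_qv⟩
  exact ⟨hS.quadVar_log, isSelfFinancing_cppi hS hr V₀ α m,
    fun t ht => portfolioValue_cppi hS r V₀ α m ht, followsCPPI_cppi hS r V₀ α m,
    fun t ht => le_cppiValue hS r m hV₀ hα.2 ht,
    fun ξ η hsf h t ht => eq_cppi_of_followsCPPI hS hr hm.ne' hsf h ht⟩
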